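/- Let $K$ be a field and let $E$ be the directed graph with two vertices $u,v$, one loop at $u$, two edges from $u$ to $v$ and one edge from $v$ to $u$. Let $E^{\mathrm{op}}$ be the graph obtained from $E$ by reversing all arrows. Their adjacency matrices are $$A_E=\begin{pmatrix}1&2\\1&0\end{pmatrix},\qquad A_{E^{\mathrm{op}}}=A_E^{t}=\begin{pmatrix}1&1\\2&0\end{pmatrix}.$$ Let $L(E)=L_K(E)$ and $L(E^{\mathrm{op}})$ be the Leavitt path algebras over $K$ with their standard $\mathbb Z$-gradings (vertices have degree $0$, edges degree $1$, ghost edges degree $-1$). For a $\mathbb Z$-graded ring $A$, let $K_0^{\mathrm{gr}}(A)$ be the group completion of the monoid $\mathcal V^{\mathrm{gr}}(A)$ of graded isomorphism classes of graded finitely generated projective right $A$-modules. It is a $\mathbb Z[x,x^{-1}]$-module via $x^n[P]=[P(n)]$, where $P(n)_k=P_{n+k}$, it is pre-ordered with the image of $\mathcal V^{\mathrm{gr}}(A)$ as positive cone, and it has the distinguished element $[A]$. Then: 1. $A_E$ and $A_{E^{\mathrm{op}}}$ are strong shift equivalent, i.e. related by the equivalence relation on square nonnegative integer matrices generated by $RS\sim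 SR$ for (rectangular) nonnegative integer matrices $R,S$. 2. $L(E)$ and $L(E^{\mathrm{op}})$ are graded Morita equivalent: there are functors between the categories of $\mathbb Z$-graded right modules over $L(E)$ and over $L(E^{\mathrm{op}})$, in both directions, that commute with all shift functors $M\mapsto M(n)$ and are mutually inverse up to natural isomorphism. 3. There is an isomorphism of $\mathbb Z[x,x^{-1}]$-modules $K_0^{\mathrm{gr}}(L(E))\cong K_0^{\mathrm{gr}}(L(E^{\mathrm{op}}))$ that preserves the order in both directions. 4. There is no order-preserving isomorphism of $\mathbb Z[x,x^{-1}]$-modules $\phi:K_0^{\mathrm{gr}}(L(E))\to K_0^{\mathrm{gr}}(L(E^{\mathrm{op}}))$ with $\phi([L(E)])=[L(E^{\mathrm{op}})]$. 5. $L(E)$ and $L(E^{\mathrm{op}})$ are not isomorphic as $\mathbb Z$-graded rings (in particular not as graded $K$-algebras). -/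

import Mathlib

open CategoryTheory DirectSum

universe u

/-! ### Strong shift equivalence of nonnegative integer matrices -/

/-- Two square nonnegative integer matrices are elementary (strong) shift equivalent if
`A = R S` and `B = S R` for nonnegative integer matrices `R`, `S`. -/
def ElementaryShiftEquivalent (A B : Σ n : ℕ, Matrix (Fin n) (Fin n) ℕ) : Prop :=
  ∃ (R : Matrix (Fin A.1) (Fin B.1) ℕ) (S : Matrix (Fin B.1) (Fin A.1) ℕ),
    A.2 = R * S ∧ B.2 = S * R

/-- Strong shift equivalence: the equivalence relation on square nonnegative integer matrices
(of all sizes) generated by elementary shift equivalence. -/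
def StrongShiftEquivalent {m n : ℕ} (A : Matrix (Fin m) (Fin m) ℕ)
    (B : Matrix (Fin n) (Fin n) ℕ) : Prop :=
  Relation.EqvGen ElementaryShiftEquivalent ⟨m, A⟩ ⟨n, B⟩

/-! ### Finite directed graphs -/

/-- A directed graph (loops and multiple edges allowed) with vertex set `V` and edge set `X`. -/
structure DirGraph (V X : Type) where
  /-- the source of an edge -/
  s : X → V
  /-- the range of an edge -/
  r : X → V

namespace DirGraph

variable {V X : Type}

/-- The opposite graph: all arrows are reversed. -/
def op (E : DirGraph V X) : DirGraph V X where
  s := E.r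
  r := E.s

/-- The adjacency matrix: the `(v, w)` entry is the number of edges from `v` to `w`. -/
def adjMatrix [Fintype X] [DecidableEq V] (E : DirGraph V X) : Matrix V V ℕ :=
  Matrix.of fun v w => (Finset.univ.filter fun e : X => E.s e = v ∧ E.r e = w).card

/-! ### Leavitt path algebras -/

/-- Generators of the Leavitt path algebra: vertices, edges and ghost edges. -/
inductive Gen (V X : Type) : Type
  | vertex : V → Gen V X
  | edge : X → Gen V X
  | ghost : X → Gen V X

/-- The standard degree of a generator. -/
def Gen.deg : Gen V X → ℤ
  | .vertex _ => 0
  | .edge _ => 1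
  | .ghost _ => -1

variable (K : Type u) [Field K] [Fintype V] [Fintype X] [DecidableEq V] [DecidableEq X]

/-- The generator `g` in the free unital algebra. -/
def fgen (g : Gen V X) : FreeAlgebra K (Gen V X) := FreeAlgebra.ι K g

/-- The defining relations of the Leavitt path algebra of a finite graph. The algebra generated by
vertices, edges and ghost edges subject to the usual relations has the identity `∑ v`; as the
quotient is taken of a free *unital* algebra, this is recorded as the relation `unit`. -/
inductive LeavittRel (E : DirGraph V X) :
    FreeAlgebra K (Gen V X) → FreeAlgebra K (Gen V X) → Prop
  | unit : LeavittRel E (∑ v : V, fgen K (.vertex v)) 1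
  | vertex_mul (v w : V) : LeavittRel E (fgen K (.vertex v) * fgen K (.vertex w))
      (if v = w then fgen K (.vertex v) else 0)
  | source_edge (e : X) : LeavittRel E (fgen K (.vertex (E.s e)) * fgen K (.edge e))
      (fgen K (.edge e))
  | edge_range (e : X) : LeavittRel E (fgen K (.edge e) * fgen K (.vertex (E.r e)))
      (fgen K (.edge e))
  | range_ghost (e : X) : LeavittRel E (fgen K (.vertex (E.r e)) * fgen K (.ghost e))
      (fgen K (.ghost e))
  | ghost_source (e : X) : LeavittRel E (fgen K (.ghost e) * fgen K (.vertex (E.s e)))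
      (fgen K (.ghost e))
  | ghost_edge (e f : X) : LeavittRel E (fgen K (.ghost e) * fgen K (.edge f))
      (if e = f then fgen K (.vertex (E.r e)) else 0)
  | sum_edge_ghost (v : V) (hv : ∃ e, E.s e = v) :
      LeavittRel E (∑ e ∈ Finset.univ.filter (fun e : X => E.s e = v),
        fgen K (.edge e) * fgen K (.ghost e)) (fgen K (.vertex v))

/-- The Leavitt path algebra `L_K(E)` of a finite graph `E`. -/
def Leavitt (E : DirGraph V X) : Type u := RingQuot (LeavittRel K E)

variable (E : DirGraph V X)

noncomputable instance : Ring (Leavitt K E) := inferInstanceAs (Ring (RingQuot (LeavittRel K E)))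

noncomputable instance : Algebra K (Leavitt K E) :=
  inferInstanceAs (Algebra K (RingQuot (LeavittRel K E)))

/-- The quotient map from the free algebra. -/
noncomputable def Leavitt.mk : FreeAlgebra K (Gen V X) →ₐ[K] Leavitt K E :=
  RingQuot.mkAlgHom K (LeavittRel K E)

/-- The image of a generator in the Leavitt path algebra. -/
noncomputable def Leavitt.gen (g : Gen V X) : Leavitt K E := Leavitt.mk K E (fgen K g)

/-- The words (products of generators) of total degree `n`. -/
def Leavitt.words (n : ℤ) : Set (Leavitt K E) :=
  {a | ∃ w : List (Gen V X), (w.map Gen.deg).sum = n ∧ a = (w.map (Leavitt.gen K E)).prod}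

/-- The standard `ℤ`-grading, `deg v = 0`, `deg e = 1`, `deg e* = -1`: the component of degree
`n` is spanned by the words of degree `n`. -/
noncomputable def Leavitt.grading (n : ℤ) : Submodule K (Leavitt K E) :=
  Submodule.span K (Leavitt.words K E n)

instance Leavitt.gradedMonoid : SetLike.GradedMonoid (Leavitt.grading K E) where
  one_mem := Submodule.subset_span ⟨[], by simp, by simp⟩
  mul_mem := by
    intro i j a b ha hb
    have h : Leavitt.grading K E i * Leavitt.grading K E j ≤ Leavitt.grading K E (i + j) := by
      unfold Leavitt.grading
      rw [Submodule.span_mul_span]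
      refine Submodule.span_mono ?_
      rintro _ ⟨_, ⟨w, hw, rfl⟩, _, ⟨w', hw', rfl⟩, rfl⟩
      exact ⟨w ++ w', by simp [hw, hw'], by simp⟩
    exact h (Submodule.mul_mem_mul ha hb)

theorem Leavitt.gen_mem (g : Gen V X) : Leavitt.gen K E g ∈ Leavitt.grading K E g.deg :=
  Submodule.subset_span ⟨[g], by simp, by simp⟩

/-- A generator as an element of the direct sum of the homogeneous components. -/
noncomputable def Leavitt.hgen (g : Gen V X) : ⨁ n, Leavitt.grading K E n :=
  DirectSum.of (fun n => Leavitt.grading K E n) g.deg ⟨Leavitt.gen K E g, Leavitt.gen_mem K E g⟩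

theorem Leavitt.of_congr {i j : ℤ} (x : Leavitt.grading K E i) (y : Leavitt.grading K E j)
    (hij : i = j) (h : (x : Leavitt K E) = y) :
    DirectSum.of (fun n => Leavitt.grading K E n) i x = DirectSum.of _ j y := by
  subst hij
  rw [Subtype.ext h]

theorem Leavitt.mk_rel {a b : FreeAlgebra K (Gen V X)} (h : LeavittRel K E a b) :
    Leavitt.mk K E a = Leavitt.mk K E b := RingQuot.mkAlgHom_rel K h

/-- The free algebra mapped to the direct sum of the homogeneous components. -/
noncomputable def Leavitt.predecompose :
    FreeAlgebra K (Gen V X) →ₐ[K] ⨁ n, Leavitt.grading K E n :=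
  FreeAlgebra.lift K (Leavitt.hgen K E)

theorem Leavitt.predecompose_gen (g : Gen V X) :
    Leavitt.predecompose K E (fgen K g) = Leavitt.hgen K E g := by
  simp [Leavitt.predecompose, fgen]

/-- Elements of the direct sum which are concentrated in one degree `n` are determined by their
sum. -/
theorem Leavitt.eq_of_homogeneous {n : ℤ} {x y : ⨁ n, Leavitt.grading K E n}
    (hx : ∃ a, x = DirectSum.of (fun n => Leavitt.grading K E n) n a)
    (hy : ∃ a, y = DirectSum.of (fun n => Leavitt.grading K E n) n a)
    (h : DirectSum.coeAlgHom (Leavitt.grading K E) x = DirectSum.coeAlgHom _ y) : x = y := by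
  obtain ⟨a, rfl⟩ := hx
  obtain ⟨b, rfl⟩ := hy
  rw [DirectSum.coeAlgHom_of, DirectSum.coeAlgHom_of] at h
  rw [Subtype.ext h]

theorem Leavitt.coe_predecompose (a : FreeAlgebra K (Gen V X)) :
    DirectSum.coeAlgHom (Leavitt.grading K E) (Leavitt.predecompose K E a) = Leavitt.mk K E a := by
  have : (DirectSum.coeAlgHom (Leavitt.grading K E)).comp (Leavitt.predecompose K E)
      = Leavitt.mk K E := by
    ext g
    have := Leavitt.predecompose_gen K E g
    simp only [fgen] at this
    simp only [Function.comp_apply, AlgHom.comp_apply, this, Leavitt.hgen,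
      DirectSum.coeAlgHom_of, Leavitt.gen, fgen]
  exact DFunLike.congr_fun this a

/-- The elements of the free algebra whose image is concentrated in degree `n`. -/
def Leavitt.Homog (n : ℤ) (a : FreeAlgebra K (Gen V X)) : Prop :=
  ∃ x, Leavitt.predecompose K E a = DirectSum.of (fun n => Leavitt.grading K E n) n x

theorem Leavitt.homog_gen (g : Gen V X) : Leavitt.Homog K E g.deg (fgen K g) :=
  ⟨_, Leavitt.predecompose_gen K E g⟩

theorem Leavitt.homog_zero (n : ℤ) : Leavitt.Homog K E n 0 := ⟨0, by simp⟩

theorem Leavitt.homog_one : Leavitt.Homog K E 0 1 :=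
  ⟨1, by rw [map_one]; rfl⟩

theorem Leavitt.homog_mul {i j n : ℤ} {a b : FreeAlgebra K (Gen V X)} (hn : i + j = n)
    (ha : Leavitt.Homog K E i a) (hb : Leavitt.Homog K E j b) : Leavitt.Homog K E n (a * b) := by
  subst hn
  obtain ⟨x, hx⟩ := ha
  obtain ⟨y, hy⟩ := hb
  exact ⟨_, by rw [map_mul, hx, hy, DirectSum.of_mul_of]⟩

theorem Leavitt.homog_sum {ι : Type} {n : ℤ} (t : Finset ι) (f : ι → FreeAlgebra K (Gen V X))
    (hf : ∀ i, Leavitt.Homog K E n (f i)) : Leavitt.Homog K E n (∑ i ∈ t, f i) := by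
  choose x hx using hf
  exact ⟨∑ i ∈ t, x i, by rw [map_sum, map_sum]; exact Finset.sum_congr rfl fun i _ => hx i⟩

theorem Leavitt.rel_homog {a b : FreeAlgebra K (Gen V X)} (h : LeavittRel K E a b) :
    ∃ n, Leavitt.Homog K E n a ∧ Leavitt.Homog K E n b := by
  have hv : ∀ v, Leavitt.Homog K E 0 (fgen K (.vertex v)) :=
    fun v => Leavitt.homog_gen K E (.vertex v)
  have he : ∀ e, Leavitt.Homog K E 1 (fgen K (.edge e)) := fun e => Leavitt.homog_gen K E (.edge e)
  have hg : ∀ e, Leavitt.Homog K E (-1) (fgen K (.ghost e)) :=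
    fun e => Leavitt.homog_gen K E (.ghost e)
  cases h with
  | unit => exact ⟨0, Leavitt.homog_sum K E _ _ hv, Leavitt.homog_one K E⟩
  | vertex_mul v w =>
    refine ⟨0, Leavitt.homog_mul K E (by norm_num) (hv v) (hv w), ?_⟩
    split_ifs
    exacts [hv v, Leavitt.homog_zero K E 0]
  | source_edge e => exact ⟨1, Leavitt.homog_mul K E (by norm_num) (hv (E.s e)) (he e), he e⟩
  | edge_range e => exact ⟨1, Leavitt.homog_mul K E (by norm_num) (he e) (hv (E.r e)), he e⟩
  | range_ghost e => exact ⟨-1, Leavitt.homog_mul K E (by norm_num) (hv (E.r e)) (hg e), hg e⟩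
  | ghost_source e => exact ⟨-1, Leavitt.homog_mul K E (by norm_num) (hg e) (hv (E.s e)), hg e⟩
  | ghost_edge e f =>
    refine ⟨0, Leavitt.homog_mul K E (by norm_num) (hg e) (he f), ?_⟩
    split_ifs
    exacts [hv (E.r e), Leavitt.homog_zero K E 0]
  | sum_edge_ghost v hs =>
    exact ⟨0, Leavitt.homog_sum K E _ _
      fun e => Leavitt.homog_mul K E (by norm_num) (he e) (hg e), hv v⟩

/-- The decomposition of `L_K(E)` into homogeneous components, as an algebra homomorphism. -/
noncomputable def Leavitt.decomp : Leavitt K E →ₐ[K] ⨁ n, Leavitt.grading K E n :=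
  RingQuot.liftAlgHom K ⟨Leavitt.predecompose K E, fun {a b} h => by
    obtain ⟨n, ha, hb⟩ := Leavitt.rel_homog K E h
    refine Leavitt.eq_of_homogeneous K E ha hb ?_
    rw [Leavitt.coe_predecompose, Leavitt.coe_predecompose, Leavitt.mk_rel K E h]⟩

theorem Leavitt.decomp_mk (a : FreeAlgebra K (Gen V X)) :
    Leavitt.decomp K E (Leavitt.mk K E a) = Leavitt.predecompose K E a :=
  RingQuot.liftAlgHom_mkAlgHom_apply K _ _ a

theorem Leavitt.mk_surjective : Function.Surjective (Leavitt.mk K E) :=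
  RingQuot.mkAlgHom_surjective K _

/-- The Leavitt path algebra is a `ℤ`-graded algebra. -/
noncomputable instance Leavitt.gradedAlgebra : GradedAlgebra (Leavitt.grading K E) :=
  GradedAlgebra.ofAlgHom _ (Leavitt.decomp K E)
    (by
      refine AlgHom.ext fun a => ?_
      obtain ⟨a, rfl⟩ := Leavitt.mk_surjective K E a
      rw [AlgHom.comp_apply, Leavitt.decomp_mk, Leavitt.coe_predecompose]
      rfl)
    (by
      have hw : ∀ (w : List (Gen V X)), ∃ h,
          Leavitt.decomp K E ((w.map (Leavitt.gen K E)).prod) =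
            DirectSum.of (fun n => Leavitt.grading K E n) (w.map Gen.deg).sum
              ⟨(w.map (Leavitt.gen K E)).prod, h⟩ := by
        intro w
        refine ⟨Submodule.subset_span ⟨w, rfl, rfl⟩, ?_⟩
        induction w with
        | nil =>
          simp only [List.map_nil, List.prod_nil, map_one]
          rfl
        | cons g w ih =>
          simp only [List.map_cons, List.prod_cons, map_mul, ih]
          have hg : Leavitt.decomp K E (Leavitt.gen K E g) = Leavitt.hgen K E g :=
            (Leavitt.decomp_mk K E _).trans (Leavitt.predecompose_gen K E g)
          rw [hg, Leavitt.hgen, DirectSum.of_mul_of]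
          exact Leavitt.of_congr K E _ _ (by simp) rfl
      rintro n ⟨x, hx⟩
      refine Submodule.span_induction
        (p := fun x hx => Leavitt.decomp K E x =
          DirectSum.of (fun n => Leavitt.grading K E n) n ⟨x, hx⟩) ?_ ?_ ?_ ?_ hx
      · rintro _ ⟨w, rfl, rfl⟩
        exact (hw w).2
      · rw [map_zero]
        exact (map_zero _).symm
      · intro x y hx hy ihx ihy
        rw [map_add, ihx, ihy, ← map_add]
        rfl
      · intro c x hx ih
        rw [map_smul, ih]
        exact (DirectSum.lof K ℤ (fun n => Leavitt.grading K E n) n).map_smul c ⟨x, hx⟩ |>.symm)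

end DirGraph

/-! ### Graded modules, shifts and graded Morita equivalence -/

section GradedModules

variable {A B σ τ : Type u} [Ring A] [SetLike σ A] [Ring B] [SetLike τ B]

/-- A `ℤ`-graded right module over the `ℤ`-graded ring `A = ⨁ 𝒜 n`. Right `A`-modules are modules
over `Aᵐᵒᵖ`. -/
structure GrMod (𝒜 : ℤ → σ) where
  /-- the underlying module -/
  carrier : Type u
  [addCommGroup : AddCommGroup carrier]
  [module : Module Aᵐᵒᵖ carrier]
  /-- the homogeneous components -/
  comp : ℤ → AddSubgroup carrier
  isInternal : DirectSum.IsInternal comp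
  smul_mem : ∀ {i j : ℤ} {m : carrier} {a : A}, m ∈ comp i → a ∈ 𝒜 j →
    MulOpposite.op a • m ∈ comp (i + j)

attribute [instance] GrMod.addCommGroup GrMod.module

namespace GrMod

variable {𝒜 : ℤ → σ} {ℬ : ℤ → τ}

/-- Graded homomorphisms: module homomorphisms which preserve degrees. -/
@[ext]
structure Hom (M N : GrMod 𝒜) where
  /-- the underlying module homomorphism -/
  toLin : M.carrier →ₗ[Aᵐᵒᵖ] N.carrier
  map_mem : ∀ (n : ℤ) (m : M.carrier), m ∈ M.comp n → toLin m ∈ N.comp n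

/-- The category `Gr-A` of graded right `A`-modules. -/
instance : Category (GrMod 𝒜) where
  Hom M N := Hom M N
  id M := ⟨LinearMap.id, fun _ _ h => h⟩
  comp f g := ⟨g.toLin ∘ₗ f.toLin, fun n m h => g.map_mem n _ (f.map_mem n m h)⟩

theorem isInternal_shift {M : Type u} [AddCommGroup M] {ℳ : ℤ → AddSubgroup M}
    (h : DirectSum.IsInternal ℳ) (α : ℤ) : DirectSum.IsInternal fun n => ℳ (n + α) := by
  let c := DirectSum.equivCongrLeft (β := fun n => ℳ n) (Equiv.subRight α)
  have key : (DirectSum.coeAddMonoidHom fun n => ℳ (n + α)) =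
      (DirectSum.coeAddMonoidHom ℳ).comp c.symm.toAddMonoidHom := by
    refine DirectSum.addHom_ext fun i y => ?_
    have hc : c.symm (DirectSum.of (fun n => ℳ (n + α)) i y) =
        DirectSum.of (fun n => ℳ n) (i + α) y := by
      refine (AddEquiv.symm_apply_eq c).2 ?_
      refine DFinsupp.ext fun k => ?_
      change _ = DirectSum.of (fun n => ℳ n) (i + α) y (k + α)
      by_cases hk : k = i
      · subst hk
        rw [DirectSum.of_eq_same, DirectSum.of_eq_same]
      · rw [DirectSum.of_eq_of_ne _ _ _ hk, DirectSum.of_eq_of_ne _ _ _ (by omega)]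
    change _ = DirectSum.coeAddMonoidHom ℳ (c.symm (DirectSum.of (fun n => ℳ (n + α)) i y))
    rw [hc, DirectSum.coeAddMonoidHom_of, DirectSum.coeAddMonoidHom_of]
  have hb : Function.Bijective ((DirectSum.coeAddMonoidHom ℳ).comp c.symm.toAddMonoidHom) :=
    h.comp c.symm.bijective
  rw [← key] at hb
  exact hb

theorem isInternal_prod {M N : Type u} [AddCommGroup M] [AddCommGroup N] {ℳ : ℤ → AddSubgroup M}
    {𝒩 : ℤ → AddSubgroup N} (hM : DirectSum.IsInternal ℳ) (hN : DirectSum.IsInternal 𝒩) :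
    DirectSum.IsInternal fun n => (ℳ n).prod (𝒩 n) := by
  have e1 : ∀ x, ((DirectSum.coeAddMonoidHom fun n => (ℳ n).prod (𝒩 n)) x).1 =
      DirectSum.coeAddMonoidHom ℳ (DirectSum.map (fun n => ((AddMonoidHom.fst M N).comp
        ((ℳ n).prod (𝒩 n)).subtype).codRestrict (ℳ n) fun x => x.2.1) x) := by
    intro x
    induction x using DirectSum.induction_on with
    | zero => simp
    | of i x => rw [DirectSum.map_of, DirectSum.coeAddMonoidHom_of, DirectSum.coeAddMonoidHom_of]; rfl
    | add x y hx hy => simp only [map_add, Prod.fst_add, hx, hy]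
  have e2 : ∀ x, ((DirectSum.coeAddMonoidHom fun n => (ℳ n).prod (𝒩 n)) x).2 =
      DirectSum.coeAddMonoidHom 𝒩 (DirectSum.map (fun n => ((AddMonoidHom.snd M N).comp
        ((ℳ n).prod (𝒩 n)).subtype).codRestrict (𝒩 n) fun x => x.2.2) x) := by
    intro x
    induction x using DirectSum.induction_on with
    | zero => simp
    | of i x => rw [DirectSum.map_of, DirectSum.coeAddMonoidHom_of, DirectSum.coeAddMonoidHom_of]; rfl
    | add x y hx hy => simp only [map_add, Prod.snd_add, hx, hy]
  constructor
  · rw [injective_iff_map_eq_zero]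
    intro x hx
    have h1 := e1 x
    have h2 := e2 x
    rw [hx] at h1 h2
    have h1' := (injective_iff_map_eq_zero _).1 hM.1 _ h1.symm
    have h2' := (injective_iff_map_eq_zero _).1 hN.1 _ h2.symm
    refine DFinsupp.ext fun n => Subtype.ext (Prod.ext ?_ ?_)
    · have := congrArg (fun z => ((z n : ℳ n) : M)) h1'
      exact this
    · have := congrArg (fun z => ((z n : 𝒩 n) : N)) h2'
      exact this
  · rintro ⟨m, n⟩
    obtain ⟨x, rfl⟩ := hM.2 m
    obtain ⟨y, rfl⟩ := hN.2 n
    refine ⟨DirectSum.map (fun n => ((AddMonoidHom.inl M N).comp (ℳ n).subtype).codRestrict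
        ((ℳ n).prod (𝒩 n)) fun x => ⟨x.2, zero_mem _⟩) x +
      DirectSum.map (fun n => ((AddMonoidHom.inr M N).comp (𝒩 n).subtype).codRestrict
        ((ℳ n).prod (𝒩 n)) fun x => ⟨zero_mem _, x.2⟩) y, ?_⟩
    rw [map_add]
    have f1 : ∀ x, (DirectSum.coeAddMonoidHom fun n => (ℳ n).prod (𝒩 n))
        (DirectSum.map (fun n => ((AddMonoidHom.inl M N).comp (ℳ n).subtype).codRestrict
          ((ℳ n).prod (𝒩 n)) fun x => ⟨x.2, zero_mem _⟩) x) =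
        (DirectSum.coeAddMonoidHom ℳ x, 0) := by
      intro x
      induction x using DirectSum.induction_on with
      | zero => simp only [map_zero]; rfl
      | of i x => rw [DirectSum.map_of, DirectSum.coeAddMonoidHom_of, DirectSum.coeAddMonoidHom_of]; rfl
      | add x y hx hy => simp only [map_add, hx, hy, Prod.mk_add_mk, add_zero]
    have f2 : ∀ y, (DirectSum.coeAddMonoidHom fun n => (ℳ n).prod (𝒩 n))
        (DirectSum.map (fun n => ((AddMonoidHom.inr M N).comp (𝒩 n).subtype).codRestrict
          ((ℳ n).prod (𝒩 n)) fun x => ⟨zero_mem _, x.2⟩) y) =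
        (0, DirectSum.coeAddMonoidHom 𝒩 y) := by
      intro x
      induction x using DirectSum.induction_on with
      | zero => simp only [map_zero]; rfl
      | of i x => rw [DirectSum.map_of, DirectSum.coeAddMonoidHom_of, DirectSum.coeAddMonoidHom_of]; rfl
      | add x y hx hy => simp only [map_add, hx, hy, Prod.mk_add_mk, add_zero]
    rw [f1, f2, Prod.mk_add_mk, add_zero, zero_add]

theorem isInternal_zero :
    DirectSum.IsInternal fun _ : ℤ => (⊥ : AddSubgroup PUnit.{u + 1}) := by
  refine ⟨fun x y _ => ?_, fun b => ⟨DirectSum.of _ 0 0, Subsingleton.elim _ _⟩⟩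
  exact DFinsupp.ext fun n => Subtype.ext (Subsingleton.elim (α := PUnit.{u + 1}) _ _)

/-- The shifted module `M(α)`, with `M(α)_n = M_{n+α}`. -/
def shift (α : ℤ) (M : GrMod 𝒜) : GrMod 𝒜 where
  carrier := M.carrier
  comp n := M.comp (n + α)
  isInternal := isInternal_shift M.isInternal α
  smul_mem {i j m a} hm ha := by
    have := M.smul_mem hm ha
    rwa [add_right_comm] at this

/-- The shift functor `T_α : Gr-A ⥤ Gr-A`, `M ↦ M(α)`. -/
def shiftFunctor (𝒜 : ℤ → σ) (α : ℤ) : GrMod 𝒜 ⥤ GrMod 𝒜 where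
  obj M := M.shift α
  map f := ⟨f.toLin, fun n m h => f.map_mem (n + α) m h⟩

/-- A graded functor commutes with all shift functors. -/
def IsGradedFunctor (φ : GrMod 𝒜 ⥤ GrMod ℬ) : Prop :=
  ∀ α : ℤ, shiftFunctor 𝒜 α ⋙ φ = φ ⋙ shiftFunctor ℬ α

end GrMod

/-- Graded Morita equivalence of the graded rings `A = ⨁ 𝒜 n` and `B = ⨁ ℬ n`: there are graded
functors between `Gr-A` and `Gr-B` which are mutually inverse up to natural isomorphism. -/
def GradedMoritaEquivalent (𝒜 : ℤ → σ) (ℬ : ℤ → τ) : Prop :=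
  ∃ (φ : GrMod 𝒜 ⥤ GrMod ℬ) (ψ : GrMod ℬ ⥤ GrMod 𝒜),
    GrMod.IsGradedFunctor φ ∧ GrMod.IsGradedFunctor ψ ∧
      Nonempty (φ ⋙ ψ ≅ 𝟭 (GrMod 𝒜)) ∧ Nonempty (ψ ⋙ φ ≅ 𝟭 (GrMod ℬ))

/-- Graded isomorphism of graded rings: a ring isomorphism which preserves the degrees. -/
def GradedIsomorphic (𝒜 : ℤ → σ) (ℬ : ℤ → τ) : Prop :=
  ∃ e : A ≃+* B, ∀ (n : ℤ) (a : A), a ∈ 𝒜 n ↔ e a ∈ ℬ n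

/-! ### The graded Grothendieck group -/

namespace GrMod

variable {𝒜 : ℤ → σ}

/-- Graded isomorphism of graded modules. -/
def IsoRel (M N : GrMod 𝒜) : Prop :=
  ∃ e : M.carrier ≃ₗ[Aᵐᵒᵖ] N.carrier, ∀ n m, m ∈ M.comp n ↔ e m ∈ N.comp n

theorem IsoRel.refl (M : GrMod 𝒜) : IsoRel M M := ⟨LinearEquiv.refl _ _, fun _ _ => Iff.rfl⟩

theorem IsoRel.symm {M N : GrMod 𝒜} : IsoRel M N → IsoRel N M := by
  rintro ⟨e, he⟩
  exact ⟨e.symm, fun n m => by simp [he]⟩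

theorem IsoRel.trans {M N P : GrMod 𝒜} : IsoRel M N → IsoRel N P → IsoRel M P := by
  rintro ⟨e, he⟩ ⟨f, hf⟩
  exact ⟨e.trans f, fun n m => by simp [he n, hf n]⟩

/-- The zero graded module. -/
def zero (𝒜 : ℤ → σ) : GrMod 𝒜 where
  carrier := PUnit.{u + 1}
  comp _ := ⊥
  isInternal := isInternal_zero
  smul_mem _ _ := Subsingleton.elim (α := PUnit.{u + 1}) _ _

/-- The direct sum `M ⊕ N` of graded modules. -/
def prod (M N : GrMod 𝒜) : GrMod 𝒜 where
  carrier := M.carrier × N.carrier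
  comp n := (M.comp n).prod (N.comp n)
  isInternal := isInternal_prod M.isInternal N.isInternal
  smul_mem hm ha := ⟨M.smul_mem hm.1 ha, N.smul_mem hm.2 ha⟩

/-- The graded ring `A` as a graded right module over itself. -/
def regular [AddSubgroupClass σ A] (𝒜 : ℤ → σ) [GradedRing 𝒜] : GrMod 𝒜 where
  carrier := A
  comp n := AddSubgroup.ofClass (𝒜 n)
  isInternal := DirectSum.Decomposition.isInternal 𝒜
  smul_mem hm ha := SetLike.mul_mem_graded hm ha

/-- The graded module `M` is finitely generated projective. -/
def FinProj (M : GrMod 𝒜) : Prop :=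
  Module.Finite Aᵐᵒᵖ M.carrier ∧ Module.Projective Aᵐᵒᵖ M.carrier

theorem FinProj.shift {M : GrMod 𝒜} (h : M.FinProj) (α : ℤ) : (M.shift α).FinProj := h

theorem FinProj.zero : (GrMod.zero 𝒜).FinProj :=
  ⟨inferInstanceAs (Module.Finite Aᵐᵒᵖ PUnit.{u + 1}), inferInstanceAs (Module.Projective Aᵐᵒᵖ PUnit.{u + 1})⟩

theorem FinProj.prod {M N : GrMod 𝒜} (hM : M.FinProj) (hN : N.FinProj) : (M.prod N).FinProj := by
  obtain ⟨_, _⟩ := hM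
  obtain ⟨_, _⟩ := hN
  exact ⟨inferInstanceAs (Module.Finite Aᵐᵒᵖ (M.carrier × N.carrier)),
    inferInstanceAs (Module.Projective Aᵐᵒᵖ (M.carrier × N.carrier))⟩

/-- `Aᵐᵒᵖ` and `A` as left modules over `Aᵐᵒᵖ`. -/
def opEquiv (A : Type u) [Ring A] : Aᵐᵒᵖ ≃ₗ[Aᵐᵒᵖ] A where
  toFun := MulOpposite.unop
  invFun := MulOpposite.op
  map_add' _ _ := rfl
  map_smul' _ _ := rfl
  left_inv _ := rfl
  right_inv _ := rfl

theorem FinProj.regular [AddSubgroupClass σ A] (𝒜 : ℤ → σ) [GradedRing 𝒜] : (GrMod.regular 𝒜).FinProj :=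
  ⟨Module.Finite.equiv (opEquiv A), Module.Projective.of_equiv (opEquiv A)⟩

/-- Graded finitely generated projective modules up to graded isomorphism. -/
instance projSetoid (𝒜 : ℤ → σ) : Setoid {M : GrMod 𝒜 // M.FinProj} where
  r M N := IsoRel M.1 N.1
  iseqv := ⟨fun M => IsoRel.refl M.1, IsoRel.symm, IsoRel.trans⟩

end GrMod

/-- The monoid `V^gr(A)` of graded isomorphism classes of graded finitely generated projective
right `A`-modules. -/
def VGr (𝒜 : ℤ → σ) : Type (u + 1) := Quotient (GrMod.projSetoid 𝒜)

namespace VGr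

variable {𝒜 : ℤ → σ}

/-- The class `[P]` in `V^gr(A)`. -/
def mk (P : GrMod 𝒜) (hP : P.FinProj) : VGr 𝒜 := Quotient.mk (GrMod.projSetoid 𝒜) ⟨P, hP⟩

/-- `[P] + [Q] = [P ⊕ Q]`. -/
instance : Add (VGr 𝒜) where
  add := Quotient.map₂ (fun P Q => ⟨P.1.prod Q.1, P.2.prod Q.2⟩) (by
    rintro P P' ⟨e, he⟩ Q Q' ⟨f, hf⟩
    exact ⟨LinearEquiv.prodCongr e f, fun n m => and_congr (he n m.1) (hf n m.2)⟩)

instance : Zero (VGr 𝒜) where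
  zero := mk (GrMod.zero 𝒜) GrMod.FinProj.zero

instance : AddCommMonoid (VGr 𝒜) where
  add_assoc := by
    rintro ⟨P⟩ ⟨Q⟩ ⟨R⟩
    exact Quotient.sound ⟨LinearEquiv.prodAssoc Aᵐᵒᵖ P.1.carrier Q.1.carrier R.1.carrier,
      fun n m => and_assoc⟩
  zero_add := by
    rintro ⟨P⟩
    exact Quotient.sound ⟨(LinearEquiv.uniqueProd :
      (PUnit.{u + 1} × P.1.carrier) ≃ₗ[Aᵐᵒᵖ] P.1.carrier),
      fun n m => and_iff_right (Subsingleton.elim (α := PUnit.{u + 1}) m.1 0)⟩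
  add_zero := by
    rintro ⟨P⟩
    exact Quotient.sound ⟨(LinearEquiv.prodUnique :
      (P.1.carrier × PUnit.{u + 1}) ≃ₗ[Aᵐᵒᵖ] P.1.carrier),
      fun n m => and_iff_left (Subsingleton.elim (α := PUnit.{u + 1}) m.2 0)⟩
  add_comm := by
    rintro ⟨P⟩ ⟨Q⟩
    exact Quotient.sound ⟨LinearEquiv.prodComm Aᵐᵒᵖ P.1.carrier Q.1.carrier,
      fun n m => and_comm⟩
  nsmul := nsmulRec

/-- The action `[P] ↦ [P(α)]` of `α ∈ ℤ` on `V^gr(A)`. -/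
def shift (α : ℤ) : VGr 𝒜 →+ VGr 𝒜 where
  toFun := Quotient.map (fun P => ⟨P.1.shift α, P.2.shift α⟩) (by
    rintro P Q ⟨e, he⟩
    exact ⟨e, fun n m => he (n + α) m⟩)
  map_zero' := Quotient.sound ⟨LinearEquiv.refl _ _, fun _ _ => Iff.rfl⟩
  map_add' := by
    rintro ⟨P⟩ ⟨Q⟩
    exact Quotient.sound ⟨LinearEquiv.refl _ _, fun _ _ => Iff.rfl⟩

theorem shift_zero (v : VGr 𝒜) : shift 0 v = v := by
  obtain ⟨P⟩ := v
  exact Quotient.sound ⟨LinearEquiv.refl _ _, fun n m => by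
    change m ∈ P.1.comp (n + 0) ↔ m ∈ P.1.comp n
    rw [add_zero]⟩

theorem shift_shift (α β : ℤ) (v : VGr 𝒜) : shift α (shift β v) = shift (α + β) v := by
  obtain ⟨P⟩ := v
  exact Quotient.sound ⟨LinearEquiv.refl _ _, fun n m => by
    change m ∈ P.1.comp (n + α + β) ↔ m ∈ P.1.comp (n + (α + β))
    rw [add_assoc]⟩

end VGr

/-- The graded Grothendieck group `K₀^gr(A)`, the group completion of `V^gr(A)`. -/
def K0Gr (𝒜 : ℤ → σ) : Type (u + 1) := Algebra.GrothendieckAddGroup (VGr 𝒜)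

namespace K0Gr

noncomputable instance (𝒜 : ℤ → σ) : AddCommGroup (K0Gr 𝒜) :=
  inferInstanceAs (AddCommGroup (Algebra.GrothendieckAddGroup (VGr 𝒜)))

variable {𝒜 : ℤ → σ}

/-- The canonical homomorphism `V^gr(A) → K₀^gr(A)`. -/
noncomputable def of (𝒜 : ℤ → σ) : VGr 𝒜 →+ K0Gr 𝒜 := Algebra.GrothendieckAddGroup.of

theorem hom_ext {G : Type*} [AddCommGroup G] {f g : K0Gr 𝒜 →+ G}
    (h : ∀ v, f (of 𝒜 v) = g (of 𝒜 v)) : f = g :=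
  Algebra.GrothendieckAddGroup.lift.symm.injective (AddMonoidHom.ext h)

/-- The endomorphism of `K₀^gr(A)` induced by the shift `[P] ↦ [P(α)]`. -/
noncomputable def shift (α : ℤ) : K0Gr 𝒜 →+ K0Gr 𝒜 :=
  Algebra.GrothendieckAddGroup.lift ((of 𝒜).comp (VGr.shift α))

theorem shift_of (α : ℤ) (v : VGr 𝒜) : shift α (of 𝒜 v) = of 𝒜 (VGr.shift α v) :=
  DFunLike.congr_fun
    (Algebra.GrothendieckAddGroup.lift.symm_apply_apply ((of 𝒜).comp (VGr.shift α))) v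

/-- The action of the group `ℤ` on `K₀^gr(A)` by shifts. -/
noncomputable def shiftHom (𝒜 : ℤ → σ) : Multiplicative ℤ →* Module.End ℤ (K0Gr 𝒜) where
  toFun α := (shift α.toAdd).toIntLinearMap
  map_one' := by
    have : shift 0 = AddMonoidHom.id (K0Gr 𝒜) :=
      hom_ext fun v => by rw [shift_of, VGr.shift_zero, AddMonoidHom.id_apply]
    exact LinearMap.ext fun x => DFunLike.congr_fun this x
  map_mul' α β := by
    have : shift (α.toAdd + β.toAdd) = (shift α.toAdd).comp (shift (𝒜 := 𝒜) β.toAdd) :=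
      hom_ext fun v => by
        rw [AddMonoidHom.comp_apply, shift_of, shift_of, shift_of, VGr.shift_shift]
    exact LinearMap.ext fun x => DFunLike.congr_fun this x

/-- `K₀^gr(A)` as a module over `ℤ[x, x⁻¹]`, where `x ^ α` acts by `[P] ↦ [P(α)]`. -/
noncomputable instance (𝒜 : ℤ → σ) : Module (LaurentPolynomial ℤ) (K0Gr 𝒜) :=
  Module.compHom (K0Gr 𝒜) (AddMonoidAlgebra.lift ℤ (Module.End ℤ (K0Gr 𝒜)) ℤ
    (shiftHom 𝒜)).toRingHom

theorem T_smul_of (α : ℤ) (v : VGr 𝒜) :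
    (LaurentPolynomial.T α : LaurentPolynomial ℤ) • of 𝒜 v = of 𝒜 (VGr.shift α v) := by
  change (AddMonoidAlgebra.lift ℤ (Module.End ℤ (K0Gr 𝒜)) ℤ (shiftHom 𝒜))
    (AddMonoidAlgebra.single α 1) (of 𝒜 v) = _
  rw [AddMonoidAlgebra.lift_single, one_smul]
  exact shift_of α v

/-- The positive cone of `K₀^gr(A)`: the image of `V^gr(A)`. -/
def cone (𝒜 : ℤ → σ) : Set (K0Gr 𝒜) := Set.range (of 𝒜)

/-- The class `[A]` of the ring itself. -/
noncomputable def unitClass [AddSubgroupClass σ A] (𝒜 : ℤ → σ) [GradedRing 𝒜] : K0Gr 𝒜 :=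
  of 𝒜 (VGr.mk (GrMod.regular 𝒜) (GrMod.FinProj.regular 𝒜))

/-- A homomorphism preserves the order if it maps the positive cone into the positive cone. -/
def OrderPreserving {𝒜 : ℤ → σ} {ℬ : ℤ → τ}
    (f : K0Gr 𝒜 →ₗ[LaurentPolynomial ℤ] K0Gr ℬ) : Prop :=
  ∀ x ∈ cone 𝒜, f x ∈ cone ℬ

end K0Gr

end GradedModules

/-! ### The graph -/

/-- The graph with vertices `0`, `1`, one loop at `0`, two edges from `0` to `1` and one edge from
`1` to `0`. -/
def exampleGraph : DirGraph (Fin 2) (Fin 4) where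
  s := ![0, 0, 0, 1]
  r := ![0, 1, 1, 0]

/-! ### Representations of Leavitt path algebras -/

/-! Positive half. With R = (1 1; 1 0) and S = diag(1, 2), both symmetric, A_E = RS and A_E^t = SR.
This factorisation lifts to the algebras: R and S become degree-preserving non-unital homomorphisms
θ : L(E) → M₂(L(Eᵒᵖ)) and θ' : L(Eᵒᵖ) → M₂(L(E)), which send a vertex to a diagonal idempotent
representing the sum of vertices prescribed by its row. Such a θ pulls a module N back to the rows
in N² fixed by θ(1). The composite Θ = θ' ∘ θ represents A_E = RS: it replaces a vertex v by the sum
of the ranges of the edges leaving v. The relations ∑ e e* = v and e* e = r(e) say that this is v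
again, up to a shift by one, and the isomorphism is multiplication by a row of edges
(`GradedMatrixHom.UnitData`). The same happens for SR, so the two functors are mutually inverse once
one of them absorbs the shift. Transporting dual bases (`finProj_obj`) shows that they preserve
finitely generated projective modules, whence the isomorphism of graded Grothendieck groups.

Negative half. Both columns of A_E have sum 2, so L(E) contains homogeneous elements satisfying the
relations of the Leavitt algebra L(1, 2), and 2x⁻¹[L(E)] = [L(E)]. The columns of A_E^t have sums 3
and 1, and the corresponding identity fails for L(Eᵒᵖ).

This failure is detected by a twisted trace. Let L(Eᵒᵖ) act on finite paths, modulo operators that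
vanish on long paths, and record for large n the trace on the paths of length n ending at vertex 0.
For a of degree k and b of degree -k, the trace of ab is that of ba shifted by k (`trace_mul`).
Hence it gives a Hattori–Stallings rank on the graded Grothendieck group. If the identity held, the
traces of the two vertices would agree eventually, but they differ by (-1)^n (`vertexTrace_sub`),
which is nonzero in every characteristic. The same trace excludes a graded ring isomorphism
directly. -/

/-- The corner `e T e` of a `K`-algebra `T` as a `K`-algebra. -/
noncomputable instance IsIdempotentElem.Corner.algebra {K T : Type*} [CommSemiring K] [Semiring T]
    [Algebra K T] {e : T} (he : IsIdempotentElem e) : Algebra K he.Corner :=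
  RingHom.toAlgebra'
    { toFun := fun k => ⟨k • e, k • e, by simp [he.eq]⟩
      map_one' := Subtype.ext (one_smul K e)
      map_mul' := fun a b => Subtype.ext (by
        change (a * b) • e = (a • e) * (b • e)
        rw [smul_mul_smul_comm, he.eq])
      map_zero' := Subtype.ext (zero_smul K e)
      map_add' := fun a b => Subtype.ext (add_smul a b e) }
    (fun k x => Subtype.ext (by
      have hx := (Subsemigroup.mem_corner_iff he).1 x.2
      change (k • e) * x.1 = x.1 * (k • e)
      rw [smul_mul_assoc, mul_smul_comm, hx.1, hx.2]))

theorem IsIdempotentElem.Corner.val_smul {K T : Type*} [CommSemiring K] [Semiring T]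
    [Algebra K T] {e : T} (he : IsIdempotentElem e) (k : K) (x : he.Corner) :
    (k • x).1 = k • x.1 := by
  have hx := (Subsemigroup.mem_corner_iff he).1 x.2
  change (k • e) * x.1 = _
  rw [smul_mul_assoc, hx.1]

namespace DirGraph

variable {V X : Type} {K : Type u} [Field K] [Fintype V] [Fintype X] [DecidableEq V]
  [DecidableEq X] {E : DirGraph V X}

/-- A family of elements indexed by the generators satisfies the relations of the Leavitt path
algebra, except that the sum of the vertices need not be the identity. -/
structure LeavittFamily {T : Type*} [Ring T] (E : DirGraph V X) (f : Gen V X → T) : Prop where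
  vertex_mul (v w : V) : f (.vertex v) * f (.vertex w) = if v = w then f (.vertex v) else 0
  source_edge (e : X) : f (.vertex (E.s e)) * f (.edge e) = f (.edge e)
  edge_range (e : X) : f (.edge e) * f (.vertex (E.r e)) = f (.edge e)
  range_ghost (e : X) : f (.vertex (E.r e)) * f (.ghost e) = f (.ghost e)
  ghost_source (e : X) : f (.ghost e) * f (.vertex (E.s e)) = f (.ghost e)
  ghost_edge (e d : X) : f (.ghost e) * f (.edge d) = if e = d then f (.vertex (E.r e)) else 0
  sum_edge_ghost (v : V) (hv : ∃ e, E.s e = v) :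
    ∑ e ∈ Finset.univ.filter (fun e : X => E.s e = v), f (.edge e) * f (.ghost e) = f (.vertex v)

namespace Leavitt

theorem family_gen (E : DirGraph V X) : LeavittFamily E (Leavitt.gen K E) where
  vertex_mul v w := by
    simpa [apply_ite, Leavitt.gen] using Leavitt.mk_rel K E (.vertex_mul v w)
  source_edge e := by simpa [Leavitt.gen] using Leavitt.mk_rel K E (.source_edge e)
  edge_range e := by simpa [Leavitt.gen] using Leavitt.mk_rel K E (.edge_range e)
  range_ghost e := by simpa [Leavitt.gen] using Leavitt.mk_rel K E (.range_ghost e)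
  ghost_source e := by simpa [Leavitt.gen] using Leavitt.mk_rel K E (.ghost_source e)
  ghost_edge e d := by
    simpa [apply_ite, Leavitt.gen] using Leavitt.mk_rel K E (.ghost_edge e d)
  sum_edge_ghost v hv := by
    simpa [Leavitt.gen] using Leavitt.mk_rel K E (.sum_edge_ghost v hv)

theorem sum_vertex (E : DirGraph V X) : ∑ v, Leavitt.gen K E (.vertex v) = 1 := by
  simpa [Leavitt.gen] using Leavitt.mk_rel K E .unit

/-- A family satisfying the relations and with `∑ v = 1` extends to the Leavitt path algebra. -/
theorem exists_algHom {T : Type*} [Ring T] [Algebra K T] {f : Gen V X → T}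
    (hf : LeavittFamily E f) (h1 : ∑ v, f (.vertex v) = 1) :
    ∃ θ : Leavitt K E →ₐ[K] T, ∀ g, θ (Leavitt.gen K E g) = f g := by
  have hι : ∀ g, FreeAlgebra.lift K f (fgen K g) = f g := fun g => by simp [fgen]
  refine ⟨RingQuot.liftAlgHom K ⟨FreeAlgebra.lift K f, fun {a b} h => ?_⟩, fun g =>
    (RingQuot.liftAlgHom_mkAlgHom_apply K _ _ _).trans (hι g)⟩
  cases h with
  | unit => simpa [hι] using h1
  | vertex_mul v w => simpa [hι, apply_ite] using hf.vertex_mul v w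
  | source_edge e => simpa [hι] using hf.source_edge e
  | edge_range e => simpa [hι] using hf.edge_range e
  | range_ghost e => simpa [hι] using hf.range_ghost e
  | ghost_source e => simpa [hι] using hf.ghost_source e
  | ghost_edge e d => simpa [hι, apply_ite] using hf.ghost_edge e d
  | sum_edge_ghost v hv => simpa [hι] using hf.sum_edge_ghost v hv

/-- A family satisfying the relations extends to a non-unital homomorphism. -/
theorem exists_nonUnitalAlgHom {T : Type*} [Ring T] [Algebra K T] {f : Gen V X → T}
    (hf : LeavittFamily E f) :
    ∃ θ : Leavitt K E →ₙₐ[K] T, ∀ g, θ (Leavitt.gen K E g) = f g := by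
  -- The sum p of the vertex images is an idempotent acting as identity on every `f g`. The family
  -- therefore lives in the corner p T p, whose unit is p, and the unital universal property applies
  -- there.
  set p := ∑ v, f (.vertex v) with hp
  have hpv : ∀ v, p * f (.vertex v) = f (.vertex v) := fun v => by
    simp [hp, Finset.sum_mul, hf.vertex_mul]
  have hvp : ∀ v, f (.vertex v) * p = f (.vertex v) := fun v => by
    simp [hp, Finset.mul_sum, hf.vertex_mul]
  have he : IsIdempotentElem p := by
    unfold IsIdempotentElem
    conv_lhs => enter [1]; rw [hp]
    rw [Finset.sum_mul, Finset.sum_congr rfl fun v _ => hvp v]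
  have hmem : ∀ g, f g ∈ Subsemigroup.corner p := fun g => by
    rw [Subsemigroup.mem_corner_iff he]
    cases g with
    | vertex v => exact ⟨hpv v, hvp v⟩
    | edge e =>
      exact ⟨by rw [← hf.source_edge, ← mul_assoc, hpv], by rw [← hf.edge_range, mul_assoc, hvp]⟩
    | ghost e =>
      exact ⟨by rw [← hf.range_ghost, ← mul_assoc, hpv], by rw [← hf.ghost_source, mul_assoc, hvp]⟩
  let F : Gen V X → he.Corner := fun g => ⟨f g, hmem g⟩
  let ι : he.Corner →+ T := ⟨⟨Subtype.val, rfl⟩, fun _ _ => rfl⟩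
  have hι : Function.Injective ι := Subtype.val_injective
  have hF : LeavittFamily E F :=
    { vertex_mul := fun v w => hι (by
        refine (hf.vertex_mul v w).trans ?_
        rw [apply_ite ι, map_zero]
        rfl)
      source_edge := fun e => hι (hf.source_edge e)
      edge_range := fun e => hι (hf.edge_range e)
      range_ghost := fun e => hι (hf.range_ghost e)
      ghost_source := fun e => hι (hf.ghost_source e)
      ghost_edge := fun e d => hι (by
        refine (hf.ghost_edge e d).trans ?_
        rw [apply_ite ι, map_zero]
        rfl)
      sum_edge_ghost := fun v hv => hι (by
        rw [map_sum]
        exact hf.sum_edge_ghost v hv) }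
  obtain ⟨θ, hθ⟩ := exists_algHom (K := K) hF (hι (by rw [map_sum]; rfl))
  refine ⟨{ toFun := fun a => ι (θ a)
            map_smul' := fun k a => ?_
            map_zero' := by simp
            map_add' := fun a b => by simp
            map_mul' := fun a b => ?_ }, fun g => congrArg ι (hθ g)⟩
  · rw [map_smul]
    exact IsIdempotentElem.Corner.val_smul he k (θ a)
  · rw [map_mul]
    rfl

/-- Every element is the sum of its homogeneous components, and each component is by definition a
combination of words. -/
theorem mem_span_words (a : Leavitt K E) :
    a ∈ Submodule.span K (Set.range fun w : List (Gen V X) => (w.map (Leavitt.gen K E)).prod) := by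
  classical
  have h := DirectSum.sum_support_decompose (Leavitt.grading K E) a
  rw [← h]
  refine Submodule.sum_mem _ fun n _ => ?_
  have := (DirectSum.decompose (Leavitt.grading K E) a n).2
  exact Submodule.span_mono (by rintro _ ⟨w, -, rfl⟩; exact ⟨w, rfl⟩) this

/-- Induction over words in the generators. -/
theorem induction {p : Leavitt K E → Prop} (one : p 1)
    (gen_mul : ∀ g a, p a → p (Leavitt.gen K E g * a))
    (zero : p 0) (add : ∀ a b, p a → p b → p (a + b)) (smul : ∀ (k : K) a, p a → p (k • a))
    (a : Leavitt K E) : p a := by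
  refine Submodule.span_induction (p := fun x _ => p x) ?_ zero (fun a b _ _ => add a b)
    (fun k a _ => smul k a) (mem_span_words a)
  rintro _ ⟨w, rfl⟩
  induction w with
  | nil => simpa using one
  | cons g w ih => simpa using gen_mul g _ ih

end Leavitt
end DirGraph

/-! ### Homogeneous components of elements of graded modules -/

section Components

variable {M : Type*} [AddCommGroup M] {ℳ : ℤ → AddSubgroup M}

/-- A family of subgroups is an internal direct sum decomposition if there are projections. -/
theorem isInternal_of_proj (π : ℤ → M →+ M) (mem : ∀ n m, π n m ∈ ℳ n)
    (same : ∀ n, ∀ m ∈ ℳ n, π n m = m) (ne : ∀ n k, n ≠ k → ∀ m ∈ ℳ k, π n m = 0)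
    (sum : ∀ m, ∃ s : Finset ℤ, ∑ n ∈ s, π n m = m) : DirectSum.IsInternal ℳ := by
  constructor
  · have key : ∀ (x : ⨁ n, ℳ n) n, π n (DirectSum.coeAddMonoidHom ℳ x) = x n := by
      intro x n
      induction x using DirectSum.induction_on with
      | zero => simp
      | of k m =>
        rw [DirectSum.coeAddMonoidHom_of]
        by_cases h : n = k
        · subst h
          rw [DirectSum.of_eq_same, same n _ m.2]
        · rw [DirectSum.of_eq_of_ne _ _ _ h, ne n k h _ m.2]
          rfl
      | add x y hx hy => rw [map_add, map_add, hx, hy]; rfl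
    rw [injective_iff_map_eq_zero]
    intro x hx
    refine DFinsupp.ext fun n => Subtype.ext ?_
    have := key x n
    rw [hx, map_zero] at this
    exact this.symm
  · intro m
    obtain ⟨s, hs⟩ := sum m
    refine ⟨∑ n ∈ s, DirectSum.of (fun n => ℳ n) n ⟨π n m, mem n m⟩, ?_⟩
    rw [map_sum]
    simpa using hs

/-- The projections of an internal direct sum decomposition. -/
theorem DirectSum.IsInternal.exists_proj (h : DirectSum.IsInternal ℳ) :
    ∃ π : ℤ → M →+ M, (∀ n m, π n m ∈ ℳ n) ∧ (∀ n, ∀ m ∈ ℳ n, π n m = m) ∧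
      (∀ n k, n ≠ k → ∀ m ∈ ℳ k, π n m = 0) ∧
      ∀ m, ∃ s : Finset ℤ, (∀ n ∉ s, π n m = 0) ∧ ∑ n ∈ s, π n m = m := by
  classical
  let := h.chooseDecomposition
  refine ⟨fun n => ((ℳ n).subtype.comp (DFinsupp.evalAddMonoidHom n)).comp
    (DirectSum.decomposeAddEquiv ℳ).toAddMonoidHom, fun n m => ?_, fun n m hm => ?_,
    fun n k hnk m hm => ?_, fun m => ⟨(DirectSum.decompose ℳ m).support, fun n hn => ?_, ?_⟩⟩
  · exact (DirectSum.decompose ℳ m n).2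
  · exact DirectSum.decompose_of_mem_same ℳ hm
  · exact DirectSum.decompose_of_mem_ne ℳ hm hnk.symm
  · have := DFinsupp.notMem_support_iff.1 hn
    exact congrArg Subtype.val this
  · exact DirectSum.sum_support_decompose ℳ m

end Components

/-! ### Functors of graded modules induced by matrix homomorphisms -/

section MatrixFunctor

variable {A B σ τ : Type u} [Ring A] [SetLike σ A] [Ring B] [SetLike τ B]
variable {𝒜 : ℤ → σ} {ℬ : ℤ → τ} {ι : Type} [Fintype ι]

/-- The product of a row vector with entries in a right module and a matrix over the ring. -/
def rowMul {R N : Type*} [Ring R] [AddCommGroup N] [Module Rᵐᵒᵖ N] {κ : Type}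
    (x : ι → N) (m : Matrix ι κ R) (j : κ) : N := ∑ i, MulOpposite.op (m i j) • x i

section rowMul

variable {R N N' : Type*} [Ring R] [AddCommGroup N] [Module Rᵐᵒᵖ N] [AddCommGroup N']
  [Module Rᵐᵒᵖ N'] {κ : Type}

theorem rowMul_add_left (x y : ι → N) (m : Matrix ι κ R) :
    rowMul (x + y) m = rowMul x m + rowMul y m := by
  funext j; simp [rowMul, Finset.sum_add_distrib]

theorem rowMul_add (x : ι → N) (m m' : Matrix ι κ R) :
    rowMul x (m + m') = rowMul x m + rowMul x m' := by
  funext j; simp [rowMul, Finset.sum_add_distrib, add_smul]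

theorem rowMul_neg_left (x : ι → N) (m : Matrix ι κ R) : rowMul (-x) m = -rowMul x m := by
  funext j; simp [rowMul]

theorem rowMul_zero_left (m : Matrix ι κ R) : rowMul (0 : ι → N) m = 0 := by
  funext j; simp [rowMul]

theorem rowMul_zero (x : ι → N) : rowMul x (0 : Matrix ι κ R) = 0 := by
  funext j; simp [rowMul]

theorem rowMul_rowMul {κ' : Type} [Fintype κ] (x : ι → N) (m : Matrix ι κ R)
    (m' : Matrix κ κ' R) : rowMul (rowMul x m) m' = rowMul x (m * m') := by
  funext j
  simp only [rowMul, Matrix.mul_apply, Finset.smul_sum, smul_smul, ← MulOpposite.op_mul,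
    Finset.op_sum, Finset.sum_smul]
  exact Finset.sum_comm

theorem map_rowMul (f : N →ₗ[Rᵐᵒᵖ] N') (x : ι → N) (m : Matrix ι κ R) (j : κ) :
    f (rowMul x m j) = rowMul (fun i => f (x i)) m j := by
  simp [rowMul]

end rowMul

/-- A non-unital ring homomorphism from a graded ring to the matrices over a graded ring which
preserves degrees. -/
structure GradedMatrixHom (𝒜 : ℤ → σ) (ℬ : ℤ → τ) (ι : Type) [Fintype ι] where
  /-- the underlying non-unital ring homomorphism -/
  toHom : A →ₙ+* Matrix ι ι B
  map_mem : ∀ {n : ℤ} {a : A}, a ∈ 𝒜 n → ∀ i j, toHom a i j ∈ ℬ n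
  -- `𝒜` is a bare family of subsets here, so `1 ∈ 𝒜 0` is not available and the degree of the
  -- idempotent θ(1) must be recorded.
  map_one_mem : ∀ i j, toHom 1 i j ∈ ℬ 0

namespace GradedMatrixHom

variable (θ : GradedMatrixHom 𝒜 ℬ ι)

theorem mul_one (a : A) : θ.toHom a * θ.toHom 1 = θ.toHom a := by rw [← map_mul, _root_.mul_one]

/-- The row vectors over `N` which are fixed by the image of `1`. -/
def rows (N : Type u) [AddCommGroup N] [Module Bᵐᵒᵖ N] : AddSubgroup (ι → N) where
  carrier := {x | rowMul x (θ.toHom 1) = x}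
  add_mem' := by
    intro x y hx hy
    rw [Set.mem_ofPred_eq] at *
    rw [rowMul_add_left, hx, hy]
  zero_mem' := rowMul_zero_left _
  neg_mem' := by
    intro x hx
    rw [Set.mem_ofPred_eq] at *
    rw [rowMul_neg_left, hx]

section rows

variable {N N' : Type u} [AddCommGroup N] [Module Bᵐᵒᵖ N] [AddCommGroup N'] [Module Bᵐᵒᵖ N']

theorem mem_rows {x : ι → N} : x ∈ θ.rows N ↔ rowMul x (θ.toHom 1) = x := Iff.rfl

theorem rowMul_mem (x : ι → N) (a : A) : rowMul x (θ.toHom a) ∈ θ.rows N := by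
  rw [mem_rows, rowMul_rowMul, θ.mul_one]

/-- A acts through θ by right multiplication on rows. As θ is not unital, this is a unital action
only on the rows fixed by θ(1), and `one_smul` is exactly that condition. -/
instance : Module Aᵐᵒᵖ (θ.rows N) where
  smul a x := ⟨rowMul x.1 (θ.toHom a.unop), θ.rowMul_mem _ _⟩
  one_smul x := Subtype.ext x.2
  mul_smul a b x := Subtype.ext (by
    change rowMul x.1 (θ.toHom (b.unop * a.unop)) = rowMul (rowMul x.1 (θ.toHom b.unop)) _
    rw [rowMul_rowMul, map_mul])
  smul_zero a := Subtype.ext (rowMul_zero_left _)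
  smul_add a x y := Subtype.ext (rowMul_add_left _ _ _)
  add_smul a b x := Subtype.ext (by
    change rowMul x.1 (θ.toHom (a.unop + b.unop)) = rowMul x.1 _ + rowMul x.1 _
    rw [map_add, rowMul_add])
  zero_smul x := Subtype.ext (by
    change rowMul x.1 (θ.toHom 0) = 0
    rw [map_zero, rowMul_zero])

theorem coe_smul (a : A) (x : θ.rows N) :
    ((MulOpposite.op a • x : θ.rows N) : ι → N) = rowMul x.1 (θ.toHom a) := rfl

/-- The map on fixed row vectors induced by a linear map. -/
def rowsMap (f : N →ₗ[Bᵐᵒᵖ] N') : θ.rows N →ₗ[Aᵐᵒᵖ] θ.rows N' where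
  toFun x := ⟨fun i => f (x.1 i), by
    rw [mem_rows]
    funext j
    rw [← map_rowMul, θ.mem_rows.1 x.2]⟩
  map_add' x y := Subtype.ext (funext fun i => map_add f _ _)
  map_smul' a x := Subtype.ext (funext fun j => map_rowMul f x.1 _ j)

end rows

/-- The graded right `A`-module obtained from a graded right `B`-module by a graded matrix
homomorphism, with the degrees shifted by `d`. -/
def obj (d : ℤ) (N : GrMod ℬ) : GrMod 𝒜 where
  carrier := θ.rows N.carrier
  comp n := (AddSubgroup.pi Set.univ fun _ => N.comp (n + d)).comap (θ.rows N.carrier).subtype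
  isInternal := by
    obtain ⟨π, mem, same, ne, sum⟩ := (GrMod.isInternal_shift N.isInternal d).exists_proj
    -- Projections commute with elements of degree 0. Since θ(1) has entries of degree 0, the
    -- components of a fixed row are again fixed rows.
    have hmul : ∀ (n : ℤ) (b : B), b ∈ ℬ 0 → ∀ m, π n (MulOpposite.op b • m) =
        MulOpposite.op b • π n m := by
      intro n b hb m
      obtain ⟨s, -, hs⟩ := sum m
      rw [← hs, Finset.smul_sum, map_sum, map_sum, Finset.smul_sum]
      refine Finset.sum_congr rfl fun k _ => ?_
      have hk : MulOpposite.op b • π k m ∈ N.comp (k + d) := by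
        simpa using N.smul_mem (mem k m) hb
      by_cases h : n = k
      · subst h
        rw [same n _ hk, same n _ (mem n m)]
      · rw [ne n k h _ hk, ne n k h _ (mem k m), smul_zero]
    refine isInternal_of_proj (fun n =>
      { toFun := fun x => ⟨fun i => π n (x.1 i), ?_⟩
        map_zero' := Subtype.ext (funext fun i => map_zero (π n))
        map_add' := fun x y => Subtype.ext (funext fun i => map_add (π n) _ _) }) ?_ ?_ ?_ ?_
    · rw [mem_rows]
      funext j
      conv_rhs => rw [← θ.mem_rows.1 x.2]
      simp only [rowMul, map_sum, hmul n _ (θ.map_one_mem _ _)]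
    · intro n x i _
      exact mem n _
    · intro n x hx
      exact Subtype.ext (funext fun i => same n _ (hx i trivial))
    · intro n k h x hx
      exact Subtype.ext (funext fun i => ne n k h _ (hx i trivial))
    · intro x
      choose s hs0 hs using fun i => sum (x.1 i)
      classical
      refine ⟨Finset.univ.biUnion s, Subtype.ext (funext fun i => ?_)⟩
      conv_rhs => rw [← hs i]
      rw [AddSubgroup.val_finsetSum, Finset.sum_apply]
      symm
      exact Finset.sum_subset (Finset.subset_biUnion_of_mem s (Finset.mem_univ i))
        fun n _ hn => hs0 i n hn
  smul_mem {n k x a} hx ha := by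
    intro j _
    refine AddSubgroup.sum_mem _ fun i _ => ?_
    have := N.smul_mem (hx i trivial) (θ.map_mem ha i j)
    rwa [add_right_comm] at this

/-- The functor on graded right modules induced by a graded matrix homomorphism. -/
def functor (d : ℤ) : GrMod ℬ ⥤ GrMod 𝒜 where
  obj N := θ.obj d N
  map f := ⟨θ.rowsMap f.toLin, fun n x hx i _ => f.map_mem _ _ (hx i trivial)⟩

end GradedMatrixHom

/-- Two graded modules with the same underlying module and the same components are equal. -/
theorem GrMod.mk_congr {M : Type u} [AddCommGroup M] [Module Aᵐᵒᵖ M] {c c' : ℤ → AddSubgroup M}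
    (h : c = c') (h1 : DirectSum.IsInternal c)
    (h2 : ∀ {i j : ℤ} {m : M} {a : A}, m ∈ c i → a ∈ 𝒜 j → MulOpposite.op a • m ∈ c (i + j))
    (h1' : DirectSum.IsInternal c')
    (h2' : ∀ {i j : ℤ} {m : M} {a : A}, m ∈ c' i → a ∈ 𝒜 j → MulOpposite.op a • m ∈ c' (i + j)) :
    (⟨M, c, h1, h2⟩ : GrMod 𝒜) = ⟨M, c', h1', h2'⟩ := by
  subst h
  rfl

/-- Graded functors commute with shifts up to equality of functors, so morphisms must be compared
across objects that are only propositionally equal. -/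
theorem GrMod.hom_heq {M N : Type u} [AddCommGroup M] [Module Aᵐᵒᵖ M] [AddCommGroup N]
    [Module Aᵐᵒᵖ N] {c c' : ℤ → AddSubgroup M} {d d' : ℤ → AddSubgroup N}
    (hc : c = c') (hd : d = d') {h1 h2 h1' h2' k1 k2 k1' k2'} (f : M →ₗ[Aᵐᵒᵖ] N) (hf hf') :
    HEq (⟨f, hf⟩ : GrMod.Hom (⟨M, c, h1, h2⟩ : GrMod 𝒜) ⟨N, d, k1, k2⟩)
      (⟨f, hf'⟩ : GrMod.Hom (⟨M, c', h1', h2'⟩ : GrMod 𝒜) ⟨N, d', k1', k2'⟩) := by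
  subst hc hd
  rfl

/-- Shifting before or after leaves carriers and linear maps untouched; only the indices n + d + α
and n + α + d of the components have to be identified. -/
theorem GradedMatrixHom.isGradedFunctor (θ : GradedMatrixHom 𝒜 ℬ ι) (d : ℤ) :
    GrMod.IsGradedFunctor (θ.functor d) := by
  intro α
  have h : ∀ N : GrMod ℬ, ((N.shift α |> θ.obj d).comp : ℤ → AddSubgroup (θ.rows N.carrier)) =
      ((θ.obj d N).shift α).comp := by
    intro N
    funext n
    change AddSubgroup.comap _ (AddSubgroup.pi _ fun _ => N.comp (n + d + α)) =
      AddSubgroup.comap _ (AddSubgroup.pi _ fun _ => N.comp (n + α + d))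
    rw [add_right_comm]
    rfl
  refine CategoryTheory.Functor.hext (fun N => ?_) (fun N N' f => ?_)
  · exact GrMod.mk_congr (h N) _ (θ.obj d (N.shift α)).smul_mem _
      ((θ.obj d N).shift α).smul_mem
  · exact GrMod.hom_heq (h N) (h N') (θ.rowsMap f.toLin) _ _

end MatrixFunctor

/-! ### Graded Morita equivalences from matrix homomorphisms -/

section DualBasis

variable {A P : Type*} [Ring A] [AddCommGroup P] [Module Aᵐᵒᵖ P]

/-- A right module with a finite dual basis is finitely generated projective. -/
theorem finite_projective_of_dualBasis {ι : Type*} [Fintype ι] (p : ι → P)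
    (f : ι → P →ₗ[Aᵐᵒᵖ] A) (h : ∀ x, ∑ i, MulOpposite.op (f i x) • p i = x) :
    Module.Finite Aᵐᵒᵖ P ∧ Module.Projective Aᵐᵒᵖ P := by
  classical
  let op : A →ₗ[Aᵐᵒᵖ] Aᵐᵒᵖ :=
    { toFun := MulOpposite.op, map_add' := fun _ _ => rfl, map_smul' := fun _ _ => rfl }
  let s : P →ₗ[Aᵐᵒᵖ] (ι → Aᵐᵒᵖ) := LinearMap.pi fun i => op ∘ₗ f i
  let π : (ι → Aᵐᵒᵖ) →ₗ[Aᵐᵒᵖ] P := Fintype.linearCombination Aᵐᵒᵖ p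
  have hπ : π ∘ₗ s = LinearMap.id := LinearMap.ext fun x => h x
  refine ⟨Module.Finite.of_surjective π fun x => ⟨s x, LinearMap.congr_fun hπ x⟩,
    Module.Projective.of_split s π hπ⟩

/-- A finite free cover of P splits: the images of the standard basis and the coordinates of the
section form a dual basis. -/
theorem exists_dualBasis [Module.Finite Aᵐᵒᵖ P] [Module.Projective Aᵐᵒᵖ P] :
    ∃ (n : ℕ) (p : Fin n → P) (f : Fin n → P →ₗ[Aᵐᵒᵖ] A),
      ∀ x, ∑ i, MulOpposite.op (f i x) • p i = x := by
  obtain ⟨n, π, s, -, -, h⟩ := Module.Finite.exists_comp_eq_id_of_projective Aᵐᵒᵖ P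
  let unop : Aᵐᵒᵖ →ₗ[Aᵐᵒᵖ] A :=
    { toFun := MulOpposite.unop, map_add' := fun _ _ => rfl, map_smul' := fun _ _ => rfl }
  refine ⟨n, fun i => π (Pi.single i 1), fun i => unop ∘ₗ LinearMap.proj i ∘ₗ s, fun x => ?_⟩
  have := LinearMap.congr_fun h x
  conv_rhs => rw [← LinearMap.id_apply (R := Aᵐᵒᵖ) x, ← this, LinearMap.comp_apply,
    LinearMap.pi_apply_eq_sum_univ π (s x)]
  refine Finset.sum_congr rfl fun i _ => ?_
  refine congrArg (fun v => s x i • π v) (funext fun j => ?_)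
  simp [Pi.single_apply, eq_comm]

end DualBasis

namespace GrMod

variable {A σ : Type u} [Ring A] [SetLike σ A] {𝒜 : ℤ → σ}

/-- A linear equivalence which preserves degrees in both directions as an isomorphism. -/
def isoOfLinearEquiv {M N : GrMod 𝒜} (e : M.carrier ≃ₗ[Aᵐᵒᵖ] N.carrier)
    (h : ∀ n m, m ∈ M.comp n → e m ∈ N.comp n)
    (h' : ∀ n m, m ∈ N.comp n → e.symm m ∈ M.comp n) : M ≅ N where
  hom := ⟨e.toLinearMap, h⟩
  inv := ⟨e.symm.toLinearMap, h'⟩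
  hom_inv_id := Hom.ext (LinearMap.ext fun x => e.symm_apply_apply x)
  inv_hom_id := Hom.ext (LinearMap.ext fun x => e.apply_symm_apply x)

theorem isoRel_of_linearEquiv {M N : GrMod 𝒜} (e : M.carrier ≃ₗ[Aᵐᵒᵖ] N.carrier)
    (h : ∀ n m, m ∈ M.comp n → e m ∈ N.comp n)
    (h' : ∀ n m, m ∈ N.comp n → e.symm m ∈ M.comp n) : IsoRel M N :=
  ⟨e, fun n m => ⟨h n m, fun hm => by simpa using h' n _ hm⟩⟩

end GrMod

namespace GradedMatrixHom

variable {A B σ τ : Type u} [Ring A] [SetLike σ A] [Ring B] [SetLike τ B]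
variable {𝒜 : ℤ → σ} {ℬ : ℤ → τ} {ι κ : Type} [Fintype ι] [Fintype κ]

/-- Elements of `A` which provide a natural isomorphism between the identity and the composition
of the functors induced by `θ` and `θ'`. -/
structure UnitData (θ : GradedMatrixHom 𝒜 ℬ ι) (θ' : GradedMatrixHom ℬ 𝒜 κ) (d : ℤ) where
  /-- the coefficients of the isomorphism -/
  e : ι → κ → A
  /-- the coefficients of its inverse -/
  g : ι → κ → A
  e_mem : ∀ i j, e i j ∈ 𝒜 d
  g_mem : ∀ i j, g i j ∈ 𝒜 (-d)
  -- Let Θ(a) be the matrix indexed by ι × κ obtained by applying θ' to the entries of θ(a). With e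
  -- as a row and g as a column, the four identities are a e = e Θ(a), g a = Θ(a) g, e g = 1 and g e
  -- = Θ(1).
  mul_e : ∀ a l k, a * e l k = ∑ i, ∑ j, e i j * θ'.toHom (θ.toHom a i l) j k
  g_mul : ∀ a i j, g i j * a = ∑ l, ∑ k, θ'.toHom (θ.toHom a i l) j k * g l k
  sum_e_g : ∑ i, ∑ j, e i j * g i j = 1
  g_e : ∀ i j l k, g i j * e l k = θ'.toHom (θ.toHom 1 i l) j k

variable {θ : GradedMatrixHom 𝒜 ℬ ι} {θ' : GradedMatrixHom ℬ 𝒜 κ} {d : ℤ}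

theorem coe_rowMul_rows {N : Type u} [AddCommGroup N] [Module Aᵐᵒᵖ N] (x : ι → θ'.rows N)
    (m : Matrix ι ι B) (l : ι) (k : κ) :
    (rowMul x m l).1 k = ∑ i, ∑ j, MulOpposite.op (θ'.toHom (m i l) j k) • (x i).1 j := by
  rw [rowMul, AddSubgroup.val_finsetSum, Finset.sum_apply]
  rfl

namespace UnitData

variable (D : UnitData θ θ' d) (M : Type u) [AddCommGroup M] [Module Aᵐᵒᵖ M]

/-- Since e = e Θ(1) and every block of Θ(1) absorbs θ'(1) on the right, each e i is fixed by θ'(1).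
This makes m · e i a legitimate element of `θ'.rows M`. -/
theorem e_mul_one (i : ι) (k : κ) : ∑ j, D.e i j * θ'.toHom 1 j k = D.e i k := by
  have h : ∀ k, D.e i k = ∑ l, ∑ j, D.e l j * θ'.toHom (θ.toHom 1 l i) j k := fun k => by
    rw [← D.mul_e, _root_.one_mul]
  conv_rhs => rw [h]
  conv_lhs => enter [2, j]; rw [h]
  simp only [Finset.sum_mul]
  rw [Finset.sum_comm]
  refine Finset.sum_congr rfl fun l _ => ?_
  rw [Finset.sum_comm]
  refine Finset.sum_congr rfl fun q _ => ?_
  conv_rhs => rw [← θ'.mul_one, Matrix.mul_apply, Finset.mul_sum]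
  exact Finset.sum_congr rfl fun j _ => mul_assoc _ _ _

/-- The isomorphism of a module with its image under the composed functors. -/
def equiv : M ≃ₗ[Aᵐᵒᵖ] θ.rows (θ'.rows M) where
  toFun m := ⟨fun i => ⟨fun j => MulOpposite.op (D.e i j) • m, by
      rw [mem_rows]
      funext k
      simp only [rowMul, smul_smul, ← MulOpposite.op_mul, ← Finset.sum_smul, ← Finset.op_sum,
        D.e_mul_one]⟩, by
    rw [mem_rows]
    funext l
    refine Subtype.ext (funext fun k => ?_)
    rw [coe_rowMul_rows]
    simp only [smul_smul, ← MulOpposite.op_mul, ← Finset.sum_smul, ← Finset.op_sum, ← D.mul_e,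
      _root_.one_mul]⟩
  map_add' m m' := Subtype.ext (funext fun i => Subtype.ext (funext fun j => smul_add _ _ _))
  map_smul' a m := Subtype.ext (funext fun l => Subtype.ext (funext fun k => by
    obtain ⟨a⟩ := a
    change MulOpposite.op (D.e l k) • MulOpposite.op a • m =
      (rowMul _ (θ.toHom a) l : θ'.rows M).1 k
    rw [coe_rowMul_rows]
    simp only [smul_smul, ← MulOpposite.op_mul, ← Finset.sum_smul, ← Finset.op_sum, ← D.mul_e]))
  invFun x := ∑ i, ∑ j, MulOpposite.op (D.g i j) • (x.1 i).1 j
  left_inv m := by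
    simp only [smul_smul, ← MulOpposite.op_mul, ← Finset.sum_smul, ← Finset.op_sum, D.sum_e_g,
      MulOpposite.op_one, one_smul]
  -- Multiplying by g and then by e is multiplication by Θ(1), which fixes x.
  right_inv x := Subtype.ext (funext fun l => Subtype.ext (funext fun k => by
    conv_rhs => rw [← θ.mem_rows.1 x.2, coe_rowMul_rows]
    simp only [Finset.smul_sum, smul_smul, ← MulOpposite.op_mul, D.g_e]))

variable {M}

theorem equiv_mem {c c' : ℤ} (h : d = c + c') (M : GrMod 𝒜) (n : ℤ) (m : M.carrier)
    (hm : m ∈ M.comp n) : D.equiv M.carrier m ∈ (θ.obj c (θ'.obj c' M)).comp n := by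
  intro i _ j _
  have := M.smul_mem hm (D.e_mem i j)
  rwa [show n + d = n + c + c' by rw [h, add_assoc]] at this

theorem equiv_symm_mem {c c' : ℤ} (h : d = c + c') (M : GrMod 𝒜) (n : ℤ)
    (x : (θ.obj c (θ'.obj c' M)).carrier) (hx : x ∈ (θ.obj c (θ'.obj c' M)).comp n) :
    (D.equiv M.carrier).symm x ∈ M.comp n := by
  refine AddSubgroup.sum_mem _ fun i _ => AddSubgroup.sum_mem _ fun j _ => ?_
  have := M.smul_mem (hx i trivial j trivial) (D.g_mem i j)
  rwa [show n + c + c' + -d = n by rw [h]; ring] at this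

theorem isoRel (D : UnitData θ θ' d) {c c' : ℤ} (h : d = c + c') (M : GrMod 𝒜) :
    GrMod.IsoRel M (θ.obj c (θ'.obj c' M)) :=
  GrMod.isoRel_of_linearEquiv (D.equiv M.carrier) (D.equiv_mem h M) (D.equiv_symm_mem h M)

/-- The natural isomorphism of the composed functors with the identity. -/
def natIso {c c' : ℤ} (h : d = c + c') : θ'.functor c' ⋙ θ.functor c ≅ 𝟭 (GrMod 𝒜) :=
  (NatIso.ofComponents (fun M => GrMod.isoOfLinearEquiv (M := M)
    (N := (θ'.functor c' ⋙ θ.functor c).obj M) (D.equiv M.carrier) (D.equiv_mem h M)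
    (D.equiv_symm_mem h M)) (fun f => GrMod.Hom.ext (LinearMap.ext fun m =>
      Subtype.ext (funext fun i => Subtype.ext (funext fun j =>
        (f.toLin.map_smul (MulOpposite.op (D.e i j)) m).symm))))).symm

/-- The functional on the module of rows induced by a functional and an index. -/
def functional {N : Type u} [AddCommGroup N] [Module Bᵐᵒᵖ N] (f : N →ₗ[Bᵐᵒᵖ] B) (s : κ) :
    θ.rows N →ₗ[Aᵐᵒᵖ] A where
  toFun x := ∑ i, ∑ j, θ'.toHom (f (x.1 i)) s j * D.g i j
  map_add' x y := by
    simp [add_mul, Finset.sum_add_distrib]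
  map_smul' a x := by
    obtain ⟨a⟩ := a
    -- Linearity of f turns the action of a into right multiplication by θ(a). After θ' this is
    -- Θ(a), and Θ(a) g = g a moves a to the right end.
    have h : ∀ i, f ((MulOpposite.op a • x : θ.rows N).1 i) = ∑ l, f (x.1 l) * θ.toHom a l i := by
      intro i
      rw [coe_smul, map_rowMul]
      rfl
    change ∑ i, ∑ j, θ'.toHom (f ((MulOpposite.op a • x : θ.rows N).1 i)) s j * D.g i j =
      (∑ l, ∑ q, θ'.toHom (f (x.1 l)) s q * D.g l q) * a
    simp only [h, map_sum, map_mul, Matrix.sum_apply, Matrix.mul_apply, Finset.sum_mul, mul_assoc,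
      D.g_mul, Finset.mul_sum]
    calc _ = ∑ i, ∑ l, ∑ j, ∑ q, θ'.toHom (f (x.1 l)) s q *
            (θ'.toHom (θ.toHom a l i) q j * D.g i j) :=
          Finset.sum_congr rfl fun i _ => Finset.sum_comm
      _ = ∑ l, ∑ i, ∑ j, ∑ q, θ'.toHom (f (x.1 l)) s q *
            (θ'.toHom (θ.toHom a l i) q j * D.g i j) := Finset.sum_comm
      _ = ∑ l, ∑ i, ∑ q, ∑ j, θ'.toHom (f (x.1 l)) s q *
            (θ'.toHom (θ.toHom a l i) q j * D.g i j) :=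
          Finset.sum_congr rfl fun l _ => Finset.sum_congr rfl fun i _ => Finset.sum_comm
      _ = _ := Finset.sum_congr rfl fun l _ => Finset.sum_comm

end UnitData

/-- The functors of a graded Morita equivalence preserve finitely generated projective modules. -/
theorem finProj_obj {d' : ℤ} (D : UnitData θ θ' d) (D' : UnitData θ' θ d')
    (triangle : ∀ i j l t, θ.toHom (D.e i j) l t = θ.toHom 1 l i * D'.e j t)
    (c : ℤ) {N : GrMod ℬ} (hN : N.FinProj) : (θ.obj c N).FinProj := by
  obtain ⟨_, _⟩ := hN
  obtain ⟨n, p, f, hpf⟩ := exists_dualBasis (A := B) (P := N.carrier)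
  -- The row m · e'_s. The new dual basis consists of the rows q_s(p_k), with the functionals built
  -- from f_k and g.
  let q : κ → N.carrier → θ.rows N.carrier := fun s m =>
    ⟨fun t => MulOpposite.op (D'.e s t) • m, by
      rw [mem_rows]
      funext k
      simp only [rowMul, smul_smul, ← MulOpposite.op_mul, ← Finset.sum_smul, ← Finset.op_sum,
        D'.e_mul_one]⟩
  -- The triangle identity enters here: the action of e_ij on a fixed row only sees its i-th
  -- coordinate. Together with e g = 1 it gives x = ∑ q_j(x_i) g_ij, into which the dual-basis
  -- expansion of x_i is substituted.
  have hq : ∀ (x : θ.rows N.carrier) i j, MulOpposite.op (D.e i j) • x = q j (x.1 i) := by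
    intro x i j
    refine Subtype.ext (funext fun t => ?_)
    have h := congrFun (θ.mem_rows.1 x.2) i
    rw [coe_smul]
    change _ = MulOpposite.op (D'.e j t) • x.1 i
    conv_rhs => rw [← h]
    simp only [rowMul, triangle, Finset.smul_sum, smul_smul, MulOpposite.op_mul]
  -- The intertwining relation b e' = e' Θ'(b), with Θ' the entrywise composite θ ∘ θ', converts
  -- coefficients from B into coefficients from A.
  have hqb : ∀ (b : B) (m : N.carrier) j, q j (MulOpposite.op b • m) =
      ∑ s, MulOpposite.op (θ'.toHom b s j) • q s m := by
    intro b m j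
    refine Subtype.ext (funext fun t => ?_)
    rw [AddSubgroup.val_finsetSum, Finset.sum_apply]
    change MulOpposite.op (D'.e j t) • MulOpposite.op b • m =
      ∑ s, rowMul (fun r => MulOpposite.op (D'.e s r) • m) (θ.toHom (θ'.toHom b s j)) t
    simp only [rowMul, smul_smul, ← MulOpposite.op_mul, ← Finset.sum_smul, ← Finset.op_sum,
      ← D'.mul_e]
  have hqsum : ∀ j (w : Fin n → N.carrier), q j (∑ k, w k) = ∑ k, q j (w k) := by
    intro j w
    refine Subtype.ext (funext fun t => ?_)
    rw [AddSubgroup.val_finsetSum, Finset.sum_apply]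
    exact Finset.smul_sum
  refine finite_projective_of_dualBasis (ι := Fin n × κ) (fun z => q z.2 (p z.1))
    (fun z => D.functional (f z.1) z.2) fun (x : θ.rows N.carrier) => ?_
  have h1 : x = ∑ i, ∑ j, MulOpposite.op (D.g i j) • q j (x.1 i) := by
    simp only [← hq, smul_smul, ← MulOpposite.op_mul, ← Finset.sum_smul, ← Finset.op_sum,
      D.sum_e_g, MulOpposite.op_one, one_smul]
  have h2 : ∀ i j, q j (x.1 i) =
      ∑ k, ∑ s, MulOpposite.op (θ'.toHom (f k (x.1 i)) s j) • q s (p k) := by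
    intro i j
    conv_lhs => rw [← hpf (x.1 i)]
    rw [hqsum]
    exact Finset.sum_congr rfl fun k _ => hqb _ _ _
  conv_rhs => rw [h1]
  simp only [h2, Finset.smul_sum, smul_smul, ← MulOpposite.op_mul]
  rw [Fintype.sum_prod_type]
  change ∑ k, ∑ s, MulOpposite.op (∑ i, ∑ j, θ'.toHom (f k (x.1 i)) s j * D.g i j) •
    q s (p k) = _
  simp only [Finset.op_sum, Finset.sum_smul]
  calc _ = ∑ k, ∑ i, ∑ s, ∑ j, MulOpposite.op (θ'.toHom (f k (x.1 i)) s j * D.g i j) •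
          q s (p k) := Finset.sum_congr rfl fun k _ => Finset.sum_comm
    _ = ∑ k, ∑ i, ∑ j, ∑ s, MulOpposite.op (θ'.toHom (f k (x.1 i)) s j * D.g i j) •
          q s (p k) := Finset.sum_congr rfl fun k _ => Finset.sum_congr rfl fun i _ =>
            Finset.sum_comm
    _ = ∑ i, ∑ k, ∑ j, ∑ s, MulOpposite.op (θ'.toHom (f k (x.1 i)) s j * D.g i j) •
          q s (p k) := Finset.sum_comm
    _ = _ := Finset.sum_congr rfl fun i _ => Finset.sum_comm

end GradedMatrixHom

/-! ### Matrix homomorphisms between Leavitt path algebras -/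

namespace DirGraph

variable {V X V' X' : Type} {K : Type u} [Field K] [Fintype V] [Fintype X] [DecidableEq V]
  [DecidableEq X] [Fintype V'] [Fintype X'] [DecidableEq V'] [DecidableEq X']

namespace Leavitt

theorem vertex_mul_vertex (E : DirGraph V X) (v w : V) :
    gen K E (.vertex v) * gen K E (.vertex w) = if v = w then gen K E (.vertex v) else 0 :=
  (family_gen E).vertex_mul v w

theorem vertex_mul_edge (E : DirGraph V X) (v : V) (e : X) :
    gen K E (.vertex v) * gen K E (.edge e) = if v = E.s e then gen K E (.edge e) else 0 := by
  rw [← (family_gen E).source_edge e, ← mul_assoc, vertex_mul_vertex]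
  split_ifs with h
  · rw [h]
  · rw [zero_mul]

theorem edge_mul_vertex (E : DirGraph V X) (v : V) (e : X) :
    gen K E (.edge e) * gen K E (.vertex v) = if E.r e = v then gen K E (.edge e) else 0 := by
  rw [← (family_gen E).edge_range e, mul_assoc, vertex_mul_vertex, mul_ite, mul_zero]

theorem vertex_mul_ghost (E : DirGraph V X) (v : V) (e : X) :
    gen K E (.vertex v) * gen K E (.ghost e) = if v = E.r e then gen K E (.ghost e) else 0 := by
  rw [← (family_gen E).range_ghost e, ← mul_assoc, vertex_mul_vertex]
  split_ifs with h
  · rw [h]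
  · rw [zero_mul]

theorem ghost_mul_vertex (E : DirGraph V X) (v : V) (e : X) :
    gen K E (.ghost e) * gen K E (.vertex v) = if E.s e = v then gen K E (.ghost e) else 0 := by
  rw [← (family_gen E).ghost_source e, mul_assoc, vertex_mul_vertex, mul_ite, mul_zero]

theorem ghost_mul_edge (E : DirGraph V X) (e d : X) :
    gen K E (.ghost e) * gen K E (.edge d) = if e = d then gen K E (.vertex (E.r e)) else 0 :=
  (family_gen E).ghost_edge e d

theorem edge_mul_edge_of_ne (E : DirGraph V X) {e d : X} (h : E.r e ≠ E.s d) :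
    gen K E (.edge e) * gen K E (.edge d) = 0 := by
  rw [← (family_gen E).edge_range e, mul_assoc, vertex_mul_edge, if_neg h, mul_zero]

theorem edge_mul_ghost_of_ne (E : DirGraph V X) {e d : X} (h : E.r e ≠ E.r d) :
    gen K E (.edge e) * gen K E (.ghost d) = 0 := by
  rw [← (family_gen E).edge_range e, mul_assoc, vertex_mul_ghost, if_neg h, mul_zero]

theorem ghost_mul_ghost_of_ne (E : DirGraph V X) {e d : X} (h : E.s e ≠ E.r d) :
    gen K E (.ghost e) * gen K E (.ghost d) = 0 := by
  rw [← (family_gen E).ghost_source e, mul_assoc, vertex_mul_ghost, if_neg h, mul_zero]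

variable {ι κ : Type} [Fintype ι] [Fintype κ]

/-- A family of matrices with homogeneous entries satisfying the relations defines a graded matrix
homomorphism. -/
theorem exists_gradedMatrixHom [DecidableEq ι] {E : DirGraph V X} {F : DirGraph V' X'}
    {f : Gen V X → Matrix ι ι (Leavitt K F)} (hf : LeavittFamily E f)
    (hdeg : ∀ g i j, f g i j ∈ grading K F g.deg) :
    ∃ θ : GradedMatrixHom (grading K E) (grading K F) ι,
      (∀ g, θ.toHom (gen K E g) = f g) ∧ ∀ (k : K) a, θ.toHom (k • a) = k • θ.toHom a := by
  obtain ⟨θ, hθ⟩ := exists_nonUnitalAlgHom (K := K) hf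
  have h1 : ∀ i j, θ 1 i j ∈ grading K F 0 := by
    intro i j
    rw [← sum_vertex, map_sum, Matrix.sum_apply]
    exact Submodule.sum_mem _ fun v _ => by
      rw [hθ]
      exact hdeg (.vertex v) i j
  refine ⟨⟨(θ : Leavitt K E →ₙ+* Matrix ι ι (Leavitt K F)), ?_, h1⟩, hθ, fun k a => map_smul θ k a⟩
  intro n a ha
  change ∀ i j, θ a i j ∈ grading K F n
  refine Submodule.span_induction (p := fun x _ => ∀ i j, θ x i j ∈ grading K F n) ?_ ?_ ?_ ?_ ha
  · rintro _ ⟨w, rfl, rfl⟩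
    clear ha
    induction w with
    | nil => exact h1
    | cons g w ih =>
      intro i j
      have h : θ ((g :: w).map (gen K E)).prod = f g * θ (w.map (gen K E)).prod := by
        rw [List.map_cons, List.prod_cons, map_mul, hθ]
      rw [h, Matrix.mul_apply, List.map_cons, List.sum_cons]
      exact Submodule.sum_mem _ fun l _ => SetLike.mul_mem_graded (hdeg g i l) (ih l j)
  · intro i j
    rw [map_zero]
    exact zero_mem _
  · intro x y _ _ hx hy i j
    rw [map_add]
    exact add_mem (hx i j) (hy i j)
  · intro k x _ hx i j
    rw [map_smul]
    exact Submodule.smul_mem _ k (hx i j)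

section intertwining

variable {E : DirGraph V X} {F : DirGraph V' X'}
  {θ : GradedMatrixHom (grading K E) (grading K F) ι}
  {θ' : GradedMatrixHom (grading K F) (grading K E) κ}

/-- An intertwining relation which holds for the generators holds for all elements. -/
theorem mul_e_of_gen (hθ : ∀ (k : K) a, θ.toHom (k • a) = k • θ.toHom a)
    (hθ' : ∀ (k : K) a, θ'.toHom (k • a) = k • θ'.toHom a) {e : ι → κ → Leavitt K E}
    (h : ∀ x l k, gen K E x * e l k =
      ∑ i, ∑ j, e i j * θ'.toHom (θ.toHom (gen K E x) i l) j k) (a : Leavitt K E) :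
    ∀ l k, a * e l k = ∑ i, ∑ j, e i j * θ'.toHom (θ.toHom a i l) j k := by
  induction a using Leavitt.induction with
  | one =>
    intro l k
    rw [← sum_vertex, Finset.sum_mul]
    simp only [h, map_sum, Matrix.sum_apply, Finset.mul_sum]
    rw [Finset.sum_comm]
    exact Finset.sum_congr rfl fun i _ => Finset.sum_comm
  | gen_mul x a ih =>
    intro l k
    rw [mul_assoc, ih, Finset.mul_sum]
    simp only [Finset.mul_sum, ← mul_assoc, h, Finset.sum_mul, map_mul, Matrix.mul_apply, map_sum,
      Matrix.sum_apply]
    calc _ = ∑ i, ∑ p, ∑ j, ∑ q, e p q * θ'.toHom (θ.toHom (gen K E x) p i) q j *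
            θ'.toHom (θ.toHom a i l) j k :=
          Finset.sum_congr rfl fun i _ => Finset.sum_comm
      _ = ∑ p, ∑ i, ∑ j, ∑ q, e p q * θ'.toHom (θ.toHom (gen K E x) p i) q j *
            θ'.toHom (θ.toHom a i l) j k := Finset.sum_comm
      _ = ∑ p, ∑ i, ∑ q, ∑ j, e p q * θ'.toHom (θ.toHom (gen K E x) p i) q j *
            θ'.toHom (θ.toHom a i l) j k :=
          Finset.sum_congr rfl fun p _ => Finset.sum_congr rfl fun i _ => Finset.sum_comm
      _ = _ := Finset.sum_congr rfl fun p _ => Finset.sum_comm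
  | zero => intro l k; simp
  | add a b iha ihb => intro l k; simp [add_mul, mul_add, Finset.sum_add_distrib, iha, ihb]
  | smul c a ih => intro l k; simp [hθ, hθ', ih, Finset.smul_sum]

theorem g_mul_of_gen (hθ : ∀ (k : K) a, θ.toHom (k • a) = k • θ.toHom a)
    (hθ' : ∀ (k : K) a, θ'.toHom (k • a) = k • θ'.toHom a) {g : ι → κ → Leavitt K E}
    (h : ∀ x i j, g i j * gen K E x =
      ∑ l, ∑ k, θ'.toHom (θ.toHom (gen K E x) i l) j k * g l k) (a : Leavitt K E) :
    ∀ i j, g i j * a = ∑ l, ∑ k, θ'.toHom (θ.toHom a i l) j k * g l k := by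
  induction a using Leavitt.induction with
  | one =>
    intro i j
    rw [← sum_vertex, Finset.mul_sum]
    simp only [h, map_sum, Matrix.sum_apply, Finset.sum_mul]
    rw [Finset.sum_comm]
    exact Finset.sum_congr rfl fun i _ => Finset.sum_comm
  | gen_mul x a ih =>
    intro i j
    rw [← mul_assoc, h, Finset.sum_mul]
    simp only [Finset.sum_mul, mul_assoc, ih, Finset.mul_sum, map_mul, Matrix.mul_apply, map_sum,
      Matrix.sum_apply]
    calc _ = ∑ p, ∑ l, ∑ q, ∑ k, θ'.toHom (θ.toHom (gen K E x) i p) j q *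
            (θ'.toHom (θ.toHom a p l) q k * g l k) :=
          Finset.sum_congr rfl fun i _ => Finset.sum_comm
      _ = ∑ l, ∑ p, ∑ q, ∑ k, θ'.toHom (θ.toHom (gen K E x) i p) j q *
            (θ'.toHom (θ.toHom a p l) q k * g l k) := Finset.sum_comm
      _ = ∑ l, ∑ p, ∑ k, ∑ q, θ'.toHom (θ.toHom (gen K E x) i p) j q *
            (θ'.toHom (θ.toHom a p l) q k * g l k) :=
          Finset.sum_congr rfl fun p _ => Finset.sum_congr rfl fun i _ => Finset.sum_comm
      _ = _ := Finset.sum_congr rfl fun p _ => Finset.sum_comm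
  | zero => intro l k; simp
  | add a b iha ihb => intro l k; simp [add_mul, mul_add, Finset.sum_add_distrib, iha, ihb]
  | smul c a ih => intro l k; simp [hθ, hθ', ih, Finset.smul_sum]

end intertwining

end Leavitt
end DirGraph

/-! ### The example -/

section Example

open DirGraph

variable (K : Type u) [Field K]

/-- The images in the matrices over `L(Eᵒᵖ)` of the generators of `L(E)`. -/
noncomputable def exampleFamily : Gen (Fin 2) (Fin 4) →
    Matrix (Fin 2) (Fin 2) (Leavitt K exampleGraph.op)
  -- The rows of R = (1 1; 1 0): vertex 0 of E becomes the sum of both vertices of Eᵒᵖ, which is 1,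
  -- and vertex 1 becomes vertex 0.
  | .vertex v => ![!![1, 0; 0, 0], !![0, 0; 0, Leavitt.gen K exampleGraph.op (.vertex 0)]] v
  | .edge e =>
    let x := fun i => Leavitt.gen K exampleGraph.op (.edge i)
    -- The edges 0 and 3 leave vertex 0 of Eᵒᵖ and have different ranges, so x 0 + x 3 identifies
    -- vertex 0 with the full unit in degree one. The edges 1 and 2 go from vertex 1 to vertex 0.
    ![!![x 0 + x 3, 0; 0, 0], !![0, x 1; 0, 0], !![0, x 2; 0, 0], !![0, 0; x 0 + x 3, 0]] e
  | .ghost e =>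
    let y := fun i => Leavitt.gen K exampleGraph.op (.ghost i)
    ![!![y 0 + y 3, 0; 0, 0], !![0, 0; y 1, 0], !![0, 0; y 2, 0], !![0, y 0 + y 3; 0, 0]] e

/-- The images in the matrices over `L(E)` of the generators of `L(Eᵒᵖ)`. -/
noncomputable def exampleFamilyOp : Gen (Fin 2) (Fin 4) →
    Matrix (Fin 2) (Fin 2) (Leavitt K exampleGraph)
  | .vertex v =>
    let p := fun i => Leavitt.gen K exampleGraph (.vertex i)
    -- The rows of S = diag(1, 2): vertex 1 of Eᵒᵖ becomes two copies of vertex 1 of E.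
    ![!![p 0, 0; 0, 0], !![p 1, 0; 0, p 1]] v
  | .edge e =>
    let x := fun i => Leavitt.gen K exampleGraph (.edge i)
    ![!![x 0, 0; 0, 0], !![x 3, 0; 0, 0], !![0, 0; x 3, 0], !![x 1, x 2; 0, 0]] e
  | .ghost e =>
    let y := fun i => Leavitt.gen K exampleGraph (.ghost i)
    ![!![y 0, 0; 0, 0], !![y 3, 0; 0, 0], !![0, y 3; 0, 0], !![y 1, 0; y 2, 0]] e

theorem exampleGraph_sum_edge_ghost_zero :
    Leavitt.gen K exampleGraph (.edge 0) * Leavitt.gen K exampleGraph (.ghost 0) +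
      Leavitt.gen K exampleGraph (.edge 1) * Leavitt.gen K exampleGraph (.ghost 1) +
      Leavitt.gen K exampleGraph (.edge 2) * Leavitt.gen K exampleGraph (.ghost 2) =
      Leavitt.gen K exampleGraph (.vertex 0) := by
  have := (Leavitt.family_gen (K := K) exampleGraph).sum_edge_ghost 0 ⟨0, rfl⟩
  rwa [show (Finset.univ.filter fun e => exampleGraph.s e = 0) = {0, 1, 2} by decide,
    Finset.sum_insert (by decide), Finset.sum_insert (by decide), Finset.sum_singleton,
    ← add_assoc] at this

theorem exampleGraph_sum_edge_ghost_one :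
    Leavitt.gen K exampleGraph (.edge 3) * Leavitt.gen K exampleGraph (.ghost 3) =
      Leavitt.gen K exampleGraph (.vertex 1) := by
  have := (Leavitt.family_gen (K := K) exampleGraph).sum_edge_ghost 1 ⟨3, rfl⟩
  rwa [show (Finset.univ.filter fun e => exampleGraph.s e = 1) = {3} by decide,
    Finset.sum_singleton] at this

theorem exampleGraph_sum_vertex : Leavitt.gen K exampleGraph (.vertex 0) +
    Leavitt.gen K exampleGraph (.vertex 1) = 1 := by
  rw [← Leavitt.sum_vertex, Fin.sum_univ_two]

theorem exampleGraph_op_sum_edge_ghost_zero :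
    Leavitt.gen K exampleGraph.op (.edge 0) * Leavitt.gen K exampleGraph.op (.ghost 0) +
      Leavitt.gen K exampleGraph.op (.edge 3) * Leavitt.gen K exampleGraph.op (.ghost 3) =
      Leavitt.gen K exampleGraph.op (.vertex 0) := by
  have := (Leavitt.family_gen (K := K) exampleGraph.op).sum_edge_ghost 0 ⟨0, rfl⟩
  rwa [show (Finset.univ.filter fun e => exampleGraph.op.s e = 0) = {0, 3} by decide,
    Finset.sum_insert (by decide), Finset.sum_singleton] at this

theorem exampleGraph_op_sum_edge_ghost_one :
    Leavitt.gen K exampleGraph.op (.edge 1) * Leavitt.gen K exampleGraph.op (.ghost 1) +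
      Leavitt.gen K exampleGraph.op (.edge 2) * Leavitt.gen K exampleGraph.op (.ghost 2) =
      Leavitt.gen K exampleGraph.op (.vertex 1) := by
  have := (Leavitt.family_gen (K := K) exampleGraph.op).sum_edge_ghost 1 ⟨1, rfl⟩
  rwa [show (Finset.univ.filter fun e => exampleGraph.op.s e = 1) = {1, 2} by decide,
    Finset.sum_insert (by decide), Finset.sum_singleton] at this

theorem exampleGraph_op_sum_vertex : Leavitt.gen K exampleGraph.op (.vertex 0) +
    Leavitt.gen K exampleGraph.op (.vertex 1) = 1 := by
  rw [← Leavitt.sum_vertex, Fin.sum_univ_two]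

end Example

/-! ### Verification of the degrees and relations for the two families of matrices -/

section Example

open DirGraph

variable (K : Type u) [Field K]

theorem exampleFamily_mem (g : Gen (Fin 2) (Fin 4)) (i j : Fin 2) :
    exampleFamily K g i j ∈ Leavitt.grading K exampleGraph.op g.deg := by
  have h := Leavitt.gen_mem K exampleGraph.op
  have h1 : (1 : Leavitt K exampleGraph.op) ∈ Leavitt.grading K exampleGraph.op 0 :=
    SetLike.one_mem_graded _
  rcases g with v | e | e
  · fin_cases v <;> fin_cases i <;> fin_cases j <;>
      first | exact zero_mem _ | exact h1 | exact h (.vertex 0)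
  · fin_cases e <;> fin_cases i <;> fin_cases j <;>
      first | exact zero_mem _ | exact h (.edge _) | exact add_mem (h (.edge 0)) (h (.edge 3))
  · fin_cases e <;> fin_cases i <;> fin_cases j <;>
      first | exact zero_mem _ | exact h (.ghost _) | exact add_mem (h (.ghost 0)) (h (.ghost 3))

theorem exampleFamilyOp_mem (g : Gen (Fin 2) (Fin 4)) (i j : Fin 2) :
    exampleFamilyOp K g i j ∈ Leavitt.grading K exampleGraph g.deg := by
  have h := Leavitt.gen_mem K exampleGraph
  have he : ∀ e, Leavitt.gen K exampleGraph (.edge e) ∈ Leavitt.grading K exampleGraph 1 :=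
    fun e => h (.edge e)
  have hg : ∀ e, Leavitt.gen K exampleGraph (.ghost e) ∈ Leavitt.grading K exampleGraph (-1) :=
    fun e => h (.ghost e)
  rcases g with v | e | e
  · fin_cases v <;> fin_cases i <;> fin_cases j <;>
      first | exact zero_mem _ | exact h (.vertex _)
  · fin_cases e <;> fin_cases i <;> fin_cases j <;>
      first | exact zero_mem _ | exact he _
  · fin_cases e <;> fin_cases i <;> fin_cases j <;>
      first | exact zero_mem _ | exact hg _

theorem exampleGraph_s : exampleGraph.s = ![0, 0, 0, 1] := rfl

theorem exampleGraph_r : exampleGraph.r = ![0, 1, 1, 0] := rfl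

theorem exampleGraph_op_s : exampleGraph.op.s = ![0, 1, 1, 0] := rfl

theorem exampleGraph_op_r : exampleGraph.op.r = ![0, 0, 0, 1] := rfl

theorem Matrix.vec_zero_two {R : Type*} [Zero R] : (![0, 0] : Fin 2 → R) = 0 := by
  simp

theorem exampleGraph_edge_mul_edge (e d : Fin 4)
    (h : ¬ (![0, 1, 1, 0] : Fin 4 → Fin 2) e = (![0, 0, 0, 1] : Fin 4 → Fin 2) d) :
    Leavitt.gen K exampleGraph (.edge e) * Leavitt.gen K exampleGraph (.edge d) = 0 :=
  Leavitt.edge_mul_edge_of_ne _ h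

theorem exampleGraph_edge_mul_ghost (e d : Fin 4)
    (h : ¬ (![0, 1, 1, 0] : Fin 4 → Fin 2) e = (![0, 1, 1, 0] : Fin 4 → Fin 2) d) :
    Leavitt.gen K exampleGraph (.edge e) * Leavitt.gen K exampleGraph (.ghost d) = 0 :=
  Leavitt.edge_mul_ghost_of_ne _ h

theorem exampleGraph_ghost_mul_ghost (e d : Fin 4)
    (h : ¬ (![0, 0, 0, 1] : Fin 4 → Fin 2) e = (![0, 1, 1, 0] : Fin 4 → Fin 2) d) :
    Leavitt.gen K exampleGraph (.ghost e) * Leavitt.gen K exampleGraph (.ghost d) = 0 :=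
  Leavitt.ghost_mul_ghost_of_ne _ h

theorem exampleGraph_op_edge_mul_edge (e d : Fin 4)
    (h : ¬ (![0, 0, 0, 1] : Fin 4 → Fin 2) e = (![0, 1, 1, 0] : Fin 4 → Fin 2) d) :
    Leavitt.gen K exampleGraph.op (.edge e) * Leavitt.gen K exampleGraph.op (.edge d) = 0 :=
  Leavitt.edge_mul_edge_of_ne _ h

theorem exampleGraph_op_edge_mul_ghost (e d : Fin 4)
    (h : ¬ (![0, 0, 0, 1] : Fin 4 → Fin 2) e = (![0, 0, 0, 1] : Fin 4 → Fin 2) d) :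
    Leavitt.gen K exampleGraph.op (.edge e) * Leavitt.gen K exampleGraph.op (.ghost d) = 0 :=
  Leavitt.edge_mul_ghost_of_ne _ h

theorem exampleGraph_op_ghost_mul_ghost (e d : Fin 4)
    (h : ¬ (![0, 1, 1, 0] : Fin 4 → Fin 2) e = (![0, 0, 0, 1] : Fin 4 → Fin 2) d) :
    Leavitt.gen K exampleGraph.op (.ghost e) * Leavitt.gen K exampleGraph.op (.ghost d) = 0 :=
  Leavitt.ghost_mul_ghost_of_ne _ h

theorem exampleFamily_family : LeavittFamily exampleGraph (exampleFamily K) where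
  vertex_mul v w := by
    fin_cases v <;> fin_cases w <;>
      simp [exampleFamily, Matrix.vec_zero_two, Leavitt.vertex_mul_vertex]
  source_edge e := by
    fin_cases e <;> simp [exampleFamily, exampleGraph_s, exampleGraph_op_s, Matrix.vec_zero_two,
      Leavitt.vertex_mul_edge, mul_add]
  edge_range e := by
    fin_cases e <;> simp [exampleFamily, exampleGraph_r, exampleGraph_op_r, Matrix.vec_zero_two,
      Leavitt.edge_mul_vertex]
  range_ghost e := by
    fin_cases e <;> simp [exampleFamily, exampleGraph_r, exampleGraph_op_r, Matrix.vec_zero_two,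
      Leavitt.vertex_mul_ghost]
  ghost_source e := by
    fin_cases e <;> simp [exampleFamily, exampleGraph_s, exampleGraph_op_s, Matrix.vec_zero_two,
      Leavitt.ghost_mul_vertex, add_mul]
  ghost_edge e d := by
    fin_cases e <;> fin_cases d <;>
      simp [exampleFamily, exampleGraph_r, exampleGraph_op_r, Matrix.vec_zero_two,
        Leavitt.ghost_mul_edge, add_mul, mul_add,
        exampleGraph_op_sum_vertex]
  sum_edge_ghost v _ := by
    have h0 := exampleGraph_op_sum_edge_ghost_zero K
    have h1 := exampleGraph_op_sum_edge_ghost_one K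
    have h2 := exampleGraph_op_sum_vertex K
    fin_cases v
    · change ∑ e ∈ Finset.univ.filter (fun e => exampleGraph.s e = 0), _ = _
      rw [show (Finset.univ.filter fun e => exampleGraph.s e = 0) = {0, 1, 2} by decide]
      simp [exampleFamily, Matrix.vec_zero_two, add_mul, mul_add,
        exampleGraph_op_edge_mul_ghost, h0, h1, h2]
    · change ∑ e ∈ Finset.univ.filter (fun e => exampleGraph.s e = 1), _ = _
      rw [show (Finset.univ.filter fun e => exampleGraph.s e = 1) = {3} by decide]
      simp [exampleFamily, Matrix.vec_zero_two, add_mul, mul_add,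
        exampleGraph_op_edge_mul_ghost, h0]

theorem exampleFamilyOp_family : LeavittFamily exampleGraph.op (exampleFamilyOp K) where
  vertex_mul v w := by
    fin_cases v <;> fin_cases w <;>
      simp [exampleFamilyOp, Matrix.vec_zero_two, Leavitt.vertex_mul_vertex]
  source_edge e := by
    fin_cases e <;> simp [exampleFamilyOp, exampleGraph_s, exampleGraph_op_s, Matrix.vec_zero_two,
      Leavitt.vertex_mul_edge]
  edge_range e := by
    fin_cases e <;> simp [exampleFamilyOp, exampleGraph_r, exampleGraph_op_r, Matrix.vec_zero_two,
      Leavitt.edge_mul_vertex]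
  range_ghost e := by
    fin_cases e <;> simp [exampleFamilyOp, exampleGraph_r, exampleGraph_op_r, Matrix.vec_zero_two,
      Leavitt.vertex_mul_ghost]
  ghost_source e := by
    fin_cases e <;> simp [exampleFamilyOp, exampleGraph_s, exampleGraph_op_s, Matrix.vec_zero_two,
      Leavitt.ghost_mul_vertex]
  ghost_edge e d := by
    fin_cases e <;> fin_cases d <;>
      simp [exampleFamilyOp, exampleGraph_r, exampleGraph_op_r, Matrix.vec_zero_two,
        Leavitt.ghost_mul_edge]
  sum_edge_ghost v _ := by
    have h0 := exampleGraph_sum_edge_ghost_zero K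
    have h1 := exampleGraph_sum_edge_ghost_one K
    fin_cases v
    · change ∑ e ∈ Finset.univ.filter (fun e => exampleGraph.op.s e = 0), _ = _
      rw [show (Finset.univ.filter fun e => exampleGraph.op.s e = 0) = {0, 3} by decide]
      simp [exampleFamilyOp, Matrix.vec_zero_two, ← add_assoc, h0]
    · change ∑ e ∈ Finset.univ.filter (fun e => exampleGraph.op.s e = 1), _ = _
      rw [show (Finset.univ.filter fun e => exampleGraph.op.s e = 1) = {1, 2} by decide]
      simp [exampleFamilyOp, Matrix.vec_zero_two, h1]

end Example

/-! ### The isomorphisms of the two composites with the identity -/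

section Example

open DirGraph

variable {K : Type u} [Field K]

section UnitData

variable {θ : GradedMatrixHom (Leavitt.grading K exampleGraph)
    (Leavitt.grading K exampleGraph.op) (Fin 2)}
  {θ' : GradedMatrixHom (Leavitt.grading K exampleGraph.op)
    (Leavitt.grading K exampleGraph) (Fin 2)}

theorem exampleFamily_map_one
    (hθ : ∀ g, θ.toHom (Leavitt.gen K exampleGraph g) = exampleFamily K g) :
    θ.toHom 1 = !![1, 0; 0, Leavitt.gen K exampleGraph.op (.vertex 0)] := by
  rw [← exampleGraph_sum_vertex, map_add, hθ, hθ]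
  simp [exampleFamily]

theorem exampleFamilyOp_map_one
    (hθ' : ∀ g, θ'.toHom (Leavitt.gen K exampleGraph.op g) = exampleFamilyOp K g) :
    θ'.toHom 1 = !![1, 0; 0, Leavitt.gen K exampleGraph (.vertex 1)] := by
  rw [← exampleGraph_op_sum_vertex, map_add, hθ', hθ']
  simp [exampleFamilyOp, exampleGraph_sum_vertex]

set_option maxHeartbeats 1000000 in
/-- The natural isomorphism between the identity of `Gr-L(E)` and the composed functors. -/
noncomputable def exampleUnitData
    (hθ : ∀ g, θ.toHom (Leavitt.gen K exampleGraph g) = exampleFamily K g)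
    (hθK : ∀ (k : K) a, θ.toHom (k • a) = k • θ.toHom a)
    (hθ' : ∀ g, θ'.toHom (Leavitt.gen K exampleGraph.op g) = exampleFamilyOp K g)
    (hθK' : ∀ (k : K) a, θ'.toHom (k • a) = k • θ'.toHom a) :
    GradedMatrixHom.UnitData θ θ' 1 :=
  let x := fun i => Leavitt.gen K exampleGraph (.edge i)
  let y := fun i => Leavitt.gen K exampleGraph (.ghost i)
  have hx : ∀ i, x i ∈ Leavitt.grading K exampleGraph 1 := fun i => Leavitt.gen_mem K _ (.edge i)
  have hy : ∀ i, y i ∈ Leavitt.grading K exampleGraph (-1) :=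
    fun i => Leavitt.gen_mem K _ (.ghost i)
  have a0 := exampleGraph_sum_edge_ghost_zero K
  have a1 := exampleGraph_sum_edge_ghost_one K
  have a2 := exampleGraph_sum_vertex K
  have h1 := exampleFamily_map_one hθ
  have h1' := exampleFamilyOp_map_one hθ'
  -- The diagonal of Θ(1) is 1, p₁, p₀, 0 at the positions (0,0), (0,1), (1,0), (1,1). Each entry of
  -- e is a sum of edges whose ranges make up that idempotent, and g consists of the corresponding
  -- ghost edges.
  { e := !![x 0 + x 1, x 2; x 3, 0]
    g := !![y 0 + y 1, y 2; y 3, 0]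
    e_mem := by
      intro i j
      fin_cases i <;> fin_cases j <;>
        first | exact zero_mem _ | exact hx _ | exact add_mem (hx 0) (hx 1)
    g_mem := by
      intro i j
      fin_cases i <;> fin_cases j <;>
        first | exact zero_mem _ | exact hy _ | exact add_mem (hy 0) (hy 1)
    mul_e := by
      refine Leavitt.mul_e_of_gen hθK hθK' fun z l k => ?_
      rcases z with v | e | e
      · fin_cases v <;> fin_cases l <;> fin_cases k <;>
          simp [x, hθ, hθ', h1', exampleFamily, exampleFamilyOp, mul_add,
            Leavitt.vertex_mul_edge, Leavitt.edge_mul_vertex, exampleGraph_s, exampleGraph_r]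
      · fin_cases e <;> fin_cases l <;> fin_cases k <;>
          simp [x, hθ, hθ', exampleFamily, exampleFamilyOp, mul_add, add_mul,
            exampleGraph_edge_mul_edge]
      · fin_cases e <;> fin_cases l <;> fin_cases k <;>
          simp [x, hθ, hθ', exampleFamily, exampleFamilyOp, mul_add, add_mul,
            exampleGraph_edge_mul_ghost, Leavitt.ghost_mul_edge, exampleGraph_r, a0, a1]
    g_mul := by
      refine Leavitt.g_mul_of_gen hθK hθK' fun z l k => ?_
      rcases z with v | e | e
      · fin_cases v <;> fin_cases l <;> fin_cases k <;>
          simp [y, hθ, hθ', h1', exampleFamily, exampleFamilyOp, add_mul,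
            Leavitt.vertex_mul_ghost, Leavitt.ghost_mul_vertex, exampleGraph_s, exampleGraph_r]
      · fin_cases e <;> fin_cases l <;> fin_cases k <;>
          simp [y, hθ, hθ', exampleFamily, exampleFamilyOp, mul_add, add_mul,
            exampleGraph_edge_mul_ghost, Leavitt.ghost_mul_edge, exampleGraph_r, a0, a1]
      · fin_cases e <;> fin_cases l <;> fin_cases k <;>
          simp [y, hθ, hθ', exampleFamily, exampleFamilyOp, mul_add, add_mul,
            exampleGraph_ghost_mul_ghost]
    sum_e_g := by
      simp [x, y, mul_add, add_mul, exampleGraph_edge_mul_ghost, a0, a1, a2]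
    g_e := by
      intro i j l k
      fin_cases i <;> fin_cases j <;> fin_cases l <;> fin_cases k <;>
        simp [x, y, h1, h1', hθ', exampleFamilyOp, mul_add, add_mul, Leavitt.ghost_mul_edge,
          exampleGraph_r, a2] }

set_option maxHeartbeats 1000000 in
/-- The natural isomorphism between the identity of `Gr-L(Eᵒᵖ)` and the composed functors. -/
noncomputable def exampleUnitDataOp
    (hθ : ∀ g, θ.toHom (Leavitt.gen K exampleGraph g) = exampleFamily K g)
    (hθK : ∀ (k : K) a, θ.toHom (k • a) = k • θ.toHom a)
    (hθ' : ∀ g, θ'.toHom (Leavitt.gen K exampleGraph.op g) = exampleFamilyOp K g)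
    (hθK' : ∀ (k : K) a, θ'.toHom (k • a) = k • θ'.toHom a) :
    GradedMatrixHom.UnitData θ' θ 1 :=
  let x' := fun i => Leavitt.gen K exampleGraph.op (.edge i)
  let y' := fun i => Leavitt.gen K exampleGraph.op (.ghost i)
  have hx' : ∀ i, x' i ∈ Leavitt.grading K exampleGraph.op 1 :=
    fun i => Leavitt.gen_mem K _ (.edge i)
  have hy' : ∀ i, y' i ∈ Leavitt.grading K exampleGraph.op (-1) :=
    fun i => Leavitt.gen_mem K _ (.ghost i)
  have b0 := exampleGraph_op_sum_edge_ghost_zero K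
  have b1 := exampleGraph_op_sum_edge_ghost_one K
  have b2 := exampleGraph_op_sum_vertex K
  have h1 := exampleFamily_map_one hθ
  have h1' := exampleFamilyOp_map_one hθ'
  -- For the reverse composite the diagonal idempotents are 1, q₀, 0, q₀ at (0,0), (0,1), (1,0),
  -- (1,1), with q₀ the vertex 0 of Eᵒᵖ; the edges are distributed by range accordingly.
  { e := !![x' 0 + x' 3, x' 1; 0, x' 2]
    g := !![y' 0 + y' 3, y' 1; 0, y' 2]
    e_mem := by
      intro i j
      fin_cases i <;> fin_cases j <;>
        first | exact zero_mem _ | exact hx' _ | exact add_mem (hx' 0) (hx' 3)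
    g_mem := by
      intro i j
      fin_cases i <;> fin_cases j <;>
        first | exact zero_mem _ | exact hy' _ | exact add_mem (hy' 0) (hy' 3)
    mul_e := by
      refine Leavitt.mul_e_of_gen hθK' hθK fun z l k => ?_
      rcases z with v | e | e
      · fin_cases v <;> fin_cases l <;> fin_cases k <;>
          simp [x', hθ, hθ', exampleFamily, exampleFamilyOp, mul_add,
            Leavitt.vertex_mul_edge, Leavitt.edge_mul_vertex, exampleGraph_op_s, exampleGraph_op_r]
      · fin_cases e <;> fin_cases l <;> fin_cases k <;>
          simp [x', hθ, hθ', exampleFamily, exampleFamilyOp, mul_add, add_mul,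
            exampleGraph_op_edge_mul_edge]
      · fin_cases e <;> fin_cases l <;> fin_cases k <;>
          simp [x', hθ, hθ', exampleFamily, exampleFamilyOp, mul_add, add_mul,
            exampleGraph_op_edge_mul_ghost, Leavitt.ghost_mul_edge, exampleGraph_op_r, b0, b1]
    g_mul := by
      refine Leavitt.g_mul_of_gen hθK' hθK fun z l k => ?_
      rcases z with v | e | e
      · fin_cases v <;> fin_cases l <;> fin_cases k <;>
          simp [y', hθ, hθ', exampleFamily, exampleFamilyOp, mul_add, add_mul,
            Leavitt.vertex_mul_ghost, Leavitt.ghost_mul_vertex, exampleGraph_op_s,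
            exampleGraph_op_r]
      · fin_cases e <;> fin_cases l <;> fin_cases k <;>
          simp [y', hθ, hθ', exampleFamily, exampleFamilyOp, mul_add, add_mul,
            exampleGraph_op_edge_mul_ghost, Leavitt.ghost_mul_edge, exampleGraph_op_r, b0, b1]
      · fin_cases e <;> fin_cases l <;> fin_cases k <;>
          simp [y', hθ, hθ', exampleFamily, exampleFamilyOp, mul_add, add_mul,
            exampleGraph_op_ghost_mul_ghost]
    sum_e_g := by
      simp [x', y', mul_add, add_mul, exampleGraph_op_edge_mul_ghost, add_assoc, b0, b1, b2]
    g_e := by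
      intro i j l k
      fin_cases i <;> fin_cases j <;> fin_cases l <;> fin_cases k <;>
        simp [x', y', h1, h1', hθ, exampleFamily, mul_add, add_mul, Leavitt.ghost_mul_edge,
          exampleGraph_op_r, b2] }

end UnitData

variable (K)

/-- The last two conditions are the triangle identities required by `finProj_obj`, one for each
functor. -/
theorem exists_example_unitData :
    ∃ (θ : GradedMatrixHom (Leavitt.grading K exampleGraph) (Leavitt.grading K exampleGraph.op)
        (Fin 2))
      (θ' : GradedMatrixHom (Leavitt.grading K exampleGraph.op) (Leavitt.grading K exampleGraph)
        (Fin 2)) (D : GradedMatrixHom.UnitData θ θ' 1) (D' : GradedMatrixHom.UnitData θ' θ 1),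
      (∀ i j l t, θ.toHom (D.e i j) l t = θ.toHom 1 l i * D'.e j t) ∧
      (∀ i j l t, θ'.toHom (D'.e i j) l t = θ'.toHom 1 l i * D.e j t) := by
  obtain ⟨θ, hθ, hθK⟩ :=
    Leavitt.exists_gradedMatrixHom (exampleFamily_family K) (exampleFamily_mem K)
  obtain ⟨θ', hθ', hθK'⟩ :=
    Leavitt.exists_gradedMatrixHom (exampleFamilyOp_family K) (exampleFamilyOp_mem K)
  have h1 := exampleFamily_map_one hθ
  have h1' := exampleFamilyOp_map_one hθ'
  refine ⟨θ, θ', exampleUnitData hθ hθK hθ' hθK', exampleUnitDataOp hθ hθK hθ' hθK', ?_, ?_⟩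
  · intro i j l t
    fin_cases i <;> fin_cases j <;> fin_cases l <;> fin_cases t <;>
      simp [exampleUnitData, exampleUnitDataOp, h1, hθ, exampleFamily, mul_add,
        Leavitt.vertex_mul_edge, exampleGraph_op_s]
  · intro i j l t
    fin_cases i <;> fin_cases j <;> fin_cases l <;> fin_cases t <;>
      simp [exampleUnitData, exampleUnitDataOp, h1', hθ', exampleFamilyOp, mul_add,
        Leavitt.vertex_mul_edge, exampleGraph_s]

end Example

/-! ### Isomorphisms of graded Grothendieck groups -/

section Grothendieck

variable {A B σ τ : Type u} [Ring A] [SetLike σ A] [Ring B] [SetLike τ B]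
variable {𝒜 : ℤ → σ} {ℬ : ℤ → τ}

namespace K0Gr

/-- An additive homomorphism which commutes with shifts is linear over the Laurent polynomials. -/
theorem map_smul_of_shift (f : K0Gr 𝒜 →+ K0Gr ℬ)
    (h : ∀ n v, f (of 𝒜 (VGr.shift n v)) =
      (LaurentPolynomial.T n : LaurentPolynomial ℤ) • f (of 𝒜 v))
    (p : LaurentPolynomial ℤ) (x : K0Gr 𝒜) : f (p • x) = p • f x := by
  -- Compatibility with monomials extends from classes of modules to their group completion, and
  -- then additively to all Laurent polynomials.
  have hT : ∀ (n : ℤ) (x : K0Gr 𝒜), f ((LaurentPolynomial.T n : LaurentPolynomial ℤ) • x) =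
      (LaurentPolynomial.T n : LaurentPolynomial ℤ) • f x := by
    intro n x
    have : f.comp (DistribSMul.toAddMonoidHom (K0Gr 𝒜) (LaurentPolynomial.T n :
        LaurentPolynomial ℤ)) = (DistribSMul.toAddMonoidHom (K0Gr ℬ) (LaurentPolynomial.T n :
        LaurentPolynomial ℤ)).comp f := hom_ext fun v => by
      change f ((LaurentPolynomial.T n : LaurentPolynomial ℤ) • of 𝒜 v) = _
      rw [T_smul_of, h]
      rfl
    exact DFunLike.congr_fun this x
  have : f.comp ((smulAddHom (LaurentPolynomial ℤ) (K0Gr 𝒜)).flip x) =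
      (smulAddHom (LaurentPolynomial ℤ) (K0Gr ℬ)).flip (f x) := by
    refine AddMonoidAlgebra.addMonoidHom_ext fun n a => ?_
    have ha : (AddMonoidAlgebra.single n a : LaurentPolynomial ℤ) = a • LaurentPolynomial.T n := by
      rw [LaurentPolynomial.T, AddMonoidAlgebra.smul_single, smul_eq_mul, mul_one]
    rw [ha, map_zsmul, map_zsmul]
    exact congrArg (a • ·) (hT n x)
  exact DFunLike.congr_fun this p

/-- The homomorphism of graded Grothendieck groups induced by a homomorphism of monoids. -/
noncomputable def map (F : VGr 𝒜 →+ VGr ℬ) : K0Gr 𝒜 →+ K0Gr ℬ :=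
  Algebra.GrothendieckAddGroup.lift ((of ℬ).comp F)

theorem map_of (F : VGr 𝒜 →+ VGr ℬ) (v : VGr 𝒜) : map F (of 𝒜 v) = of ℬ (F v) :=
  DFunLike.congr_fun
    (Algebra.GrothendieckAddGroup.lift.symm_apply_apply ((of ℬ).comp F)) v

theorem map_map {F : VGr 𝒜 →+ VGr ℬ} {G : VGr ℬ →+ VGr 𝒜} (h : ∀ v, G (F v) = v)
    (x : K0Gr 𝒜) : map G (map F x) = x := by
  have : (map G).comp (map F) = AddMonoidHom.id _ := hom_ext fun v => by
    rw [AddMonoidHom.comp_apply, map_of, map_of, h, AddMonoidHom.id_apply]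
  exact DFunLike.congr_fun this x

/-- Mutually inverse homomorphisms of the monoids `V^gr` which commute with the shift induce an
isomorphism of preordered modules. -/
theorem exists_linearEquiv (F : VGr 𝒜 →+ VGr ℬ) (G : VGr ℬ →+ VGr 𝒜) (hGF : ∀ v, G (F v) = v)
    (hFG : ∀ v, F (G v) = v) (hF : ∀ n v, F (VGr.shift n v) = VGr.shift n (F v)) :
    ∃ φ : K0Gr 𝒜 ≃ₗ[LaurentPolynomial ℤ] K0Gr ℬ,
      OrderPreserving φ.toLinearMap ∧ OrderPreserving φ.symm.toLinearMap := by
  refine ⟨{ map F with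
    map_smul' := fun p x => map_smul_of_shift (map F) (fun n v => ?_) p x
    invFun := map G
    left_inv := map_map hGF
    right_inv := map_map hFG }, ?_, ?_⟩
  · rw [map_of, map_of, T_smul_of, hF]
  · rintro _ ⟨v, rfl⟩
    exact ⟨F v, (map_of F v).symm⟩
  · rintro _ ⟨v, rfl⟩
    exact ⟨G v, (map_of G v).symm⟩

end K0Gr

namespace GradedMatrixHom

variable {ι : Type} [Fintype ι] (θ : GradedMatrixHom 𝒜 ℬ ι)

/-- The homomorphism of the monoids `V^gr` induced by a graded matrix homomorphism. -/
def vgrMap (d : ℤ) (hfp : ∀ N : GrMod ℬ, N.FinProj → (θ.obj d N).FinProj) : VGr ℬ →+ VGr 𝒜 where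
  toFun := Quotient.map (fun N => ⟨θ.obj d N.1, hfp N.1 N.2⟩) (by
    rintro N N' ⟨e, he⟩
    refine GrMod.isoRel_of_linearEquiv (LinearEquiv.ofLinearMap (θ.rowsMap e.toLinearMap)
      (θ.rowsMap e.symm.toLinearMap)
      (LinearMap.ext fun x => Subtype.ext (funext fun i => e.apply_symm_apply _))
      (LinearMap.ext fun x => Subtype.ext (funext fun i => e.symm_apply_apply _))) ?_ ?_
    · exact fun n x hx i _ => (he _ _).1 (hx i trivial)
    · refine fun n x hx i _ => (he _ _).2 ?_
      exact (e.apply_symm_apply (x.1 i)).symm ▸ hx i trivial)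
  map_zero' := Quotient.sound (by
    refine GrMod.isoRel_of_linearEquiv (N := GrMod.zero 𝒜) (LinearEquiv.ofLinearMap 0 0
      (LinearMap.ext fun x => Subsingleton.elim (α := PUnit.{u + 1}) _ _)
      (LinearMap.ext fun x => Subtype.ext (funext fun i =>
        Subsingleton.elim (α := PUnit.{u + 1}) _ _))) ?_ ?_
    · exact fun n x _ => Subsingleton.elim (α := PUnit.{u + 1}) _ _
    · exact fun n x _ i _ => Subsingleton.elim (α := PUnit.{u + 1}) _ _)
  map_add' := by
    rintro ⟨N⟩ ⟨N'⟩
    refine Quotient.sound ?_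
    let fst : (N.1.carrier × N'.1.carrier) →ₗ[Bᵐᵒᵖ] N.1.carrier := LinearMap.fst _ _ _
    let snd : (N.1.carrier × N'.1.carrier) →ₗ[Bᵐᵒᵖ] N'.1.carrier := LinearMap.snd _ _ _
    let inl : N.1.carrier →ₗ[Bᵐᵒᵖ] (N.1.carrier × N'.1.carrier) := LinearMap.inl _ _ _
    let inr : N'.1.carrier →ₗ[Bᵐᵒᵖ] (N.1.carrier × N'.1.carrier) := LinearMap.inr _ _ _
    refine GrMod.isoRel_of_linearEquiv (N := (θ.obj d N.1).prod (θ.obj d N'.1))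
      (LinearEquiv.ofLinearMap ((θ.rowsMap fst).prod (θ.rowsMap snd))
        ((θ.rowsMap inl).coprod (θ.rowsMap inr)) ?_ ?_) ?_ ?_
    · refine LinearMap.ext fun x => Prod.ext (Subtype.ext (funext fun i => ?_))
        (Subtype.ext (funext fun i => ?_))
      · change x.1.1 i + 0 = x.1.1 i
        rw [add_zero]
      · change 0 + x.2.1 i = x.2.1 i
        rw [zero_add]
    · refine LinearMap.ext fun x => Subtype.ext (funext fun i => ?_)
      change ((x.1 i).1, (0 : N'.1.carrier)) + ((0 : N.1.carrier), (x.1 i).2) = x.1 i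
      rw [Prod.mk_add_mk, add_zero, zero_add]
      rfl
    · exact fun n x hx => ⟨fun i _ => (hx i trivial).1, fun i _ => (hx i trivial).2⟩
    · intro n x hx i _
      refine AddSubgroup.add_mem _ ?_ ?_
      · exact ⟨hx.1 i trivial, zero_mem _⟩
      · exact ⟨zero_mem _, hx.2 i trivial⟩

theorem vgrMap_shift (d : ℤ) (hfp : ∀ N : GrMod ℬ, N.FinProj → (θ.obj d N).FinProj) (n : ℤ)
    (v : VGr ℬ) : θ.vgrMap d hfp (VGr.shift n v) = VGr.shift n (θ.vgrMap d hfp v) := by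
  obtain ⟨N⟩ := v
  refine Quotient.sound ⟨LinearEquiv.refl _ _, fun k x => ?_⟩
  change (∀ i ∈ Set.univ, x.1 i ∈ N.1.comp (k + d + n)) ↔
    ∀ i ∈ Set.univ, x.1 i ∈ N.1.comp (k + n + d)
  rw [add_right_comm]

end GradedMatrixHom

end Grothendieck

/-! ### Graded Morita equivalence and the isomorphism of graded Grothendieck groups -/

section Example

open DirGraph

variable (K : Type u) [Field K]

theorem exampleGraph_gradedMoritaEquivalent :
    GradedMoritaEquivalent (Leavitt.grading K exampleGraph)
      (Leavitt.grading K exampleGraph.op) := by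
  obtain ⟨θ, θ', D, D', -, -⟩ := exists_example_unitData K
  -- Both composites are the identity up to the degree 1 of the edges, so exactly one of the two
  -- functors carries a shift by 1.
  exact ⟨θ'.functor 1, θ.functor 0, θ'.isGradedFunctor 1, θ.isGradedFunctor 0,
    ⟨D.natIso (by norm_num)⟩, ⟨D'.natIso (by norm_num)⟩⟩

theorem exampleGraph_k0Gr :
    ∃ φ : K0Gr (Leavitt.grading K exampleGraph) ≃ₗ[LaurentPolynomial ℤ]
        K0Gr (Leavitt.grading K exampleGraph.op),
      K0Gr.OrderPreserving φ.toLinearMap ∧ K0Gr.OrderPreserving φ.symm.toLinearMap := by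
  obtain ⟨θ, θ', D, D', h, h'⟩ := exists_example_unitData K
  have hΦ : ∀ N, N.FinProj → (θ.obj 0 N).FinProj :=
    fun N => GradedMatrixHom.finProj_obj D D' h 0
  have hΨ : ∀ N, N.FinProj → (θ'.obj 1 N).FinProj :=
    fun N => GradedMatrixHom.finProj_obj D' D h' 1
  refine K0Gr.exists_linearEquiv (θ'.vgrMap 1 hΨ) (θ.vgrMap 0 hΦ) ?_ ?_ (θ'.vgrMap_shift 1 hΨ)
  · rintro ⟨M⟩
    exact Quotient.sound (D.isoRel (by norm_num) M.1).symm
  · rintro ⟨N⟩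
    exact Quotient.sound (D'.isoRel (by norm_num) N.1).symm

end Example

/-! ### A twisted trace on `L(Eᵒᵖ)`

Every vertex of `Eᵒᵖ` emits exactly two edges, so that a path is given by its source and a list of
booleans. The free algebra acts on the span of the paths, and the relations of the Leavitt path
algebra hold on long paths. -/

namespace PathTrace

open DirGraph

/-- The label which distinguishes the two edges with the same source. -/
def bit : Fin 4 → Bool := ![false, false, true, true]

/-- The range of the edge with given source and label. -/
def next : Fin 2 → Bool → Fin 2 := fun v b => if v = 0 ∧ b then 1 else 0

/-- The end of a path. -/
def final : Fin 2 → List Bool → Fin 2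
  | v, [] => v
  | v, b :: w => final (next v b) w

theorem next_bit (e : Fin 4) : next (exampleGraph.op.s e) (bit e) = exampleGraph.op.r e := by
  revert e; decide

/-- Paths, encoded by the source and the labels of the edges. -/
abbrev Path : Type := Fin 2 × List Bool

theorem finite_length (n : ℤ) : {p : Path | (p.2.length : ℤ) = n}.Finite := by
  refine (Set.finite_univ.prod (List.finite_length_eq Bool n.toNat)).subset ?_
  rintro ⟨v, w⟩ h
  refine ⟨trivial, ?_⟩
  change (w.length : ℤ) = n at h
  change w.length = n.toNat
  omega

/-- The set of paths of length `n`. -/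
noncomputable def paths (n : ℤ) : Finset Path := (finite_length n).toFinset

theorem mem_paths {n : ℤ} {p : Path} : p ∈ paths n ↔ (p.2.length : ℤ) = n := by simp [paths]

variable (K : Type u) [Field K]

/-- The action of a generator on paths. -/
noncomputable def genPath : Gen (Fin 2) (Fin 4) → Path → (Path →₀ K)
  | .vertex v, p => if p.1 = v then Finsupp.single p 1 else 0
  | .edge e, p => if p.1 = exampleGraph.op.r e then
      Finsupp.single (exampleGraph.op.s e, bit e :: p.2) 1 else 0
  -- Ghost edges kill trivial paths. This is why ∑ e e* = v fails on paths of length 0, and why long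
  -- paths are needed.
  | .ghost _, (_, []) => 0
  | .ghost e, (v, b :: w) => if v = exampleGraph.op.s e ∧ b = bit e then
      Finsupp.single (exampleGraph.op.r e, w) 1 else 0

/-- The action of the free algebra on the span of the paths. -/
noncomputable def rep : FreeAlgebra K (Gen (Fin 2) (Fin 4)) →ₐ[K] Module.End K (Path →₀ K) :=
  FreeAlgebra.lift K fun g => Finsupp.linearCombination K (genPath K g)

variable {K}

theorem rep_fgen_single (g : Gen (Fin 2) (Fin 4)) (p : Path) :
    rep K (fgen K g) (Finsupp.single p 1) = genPath K g p := by
  simp [rep, fgen]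

/-- The operator has degree `k` and preserves the end of paths. -/
def Homogeneous (k : ℤ) (f : Module.End K (Path →₀ K)) : Prop :=
  ∀ p q, f (Finsupp.single p 1) q ≠ 0 →
    (q.2.length : ℤ) = p.2.length + k ∧ final q.1 q.2 = final p.1 p.2

theorem apply_eq_sum (f : Module.End K (Path →₀ K)) (x : Path →₀ K) :
    f x = x.sum fun p c => c • f (Finsupp.single p 1) := by
  conv_lhs => rw [← Finsupp.sum_single x]
  rw [map_finsuppSum]
  exact Finsupp.sum_congr fun p _ => by rw [← map_smul, Finsupp.smul_single, smul_eq_mul, mul_one]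

theorem exists_of_mul_ne_zero {f g : Module.End K (Path →₀ K)} {p q : Path}
    (h : (f * g) (Finsupp.single p 1) q ≠ 0) :
    ∃ r, g (Finsupp.single p 1) r ≠ 0 ∧ f (Finsupp.single r 1) q ≠ 0 := by
  by_contra! hc
  apply h
  rw [Module.End.mul_apply, apply_eq_sum, Finsupp.sum, Finsupp.finsetSum_apply]
  refine Finset.sum_eq_zero fun r hr => ?_
  rw [Finsupp.smul_apply, hc r (Finsupp.mem_support_iff.1 hr), smul_zero]

theorem Homogeneous.mul {k l : ℤ} {f g : Module.End K (Path →₀ K)} (hf : Homogeneous k f)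
    (hg : Homogeneous l g) : Homogeneous (k + l) (f * g) := by
  intro p q h
  obtain ⟨r, h1, h2⟩ := exists_of_mul_ne_zero h
  obtain ⟨h3, h4⟩ := hg p r h1
  obtain ⟨h5, h6⟩ := hf r q h2
  exact ⟨by omega, h6.trans h4⟩

theorem Homogeneous.add {k : ℤ} {f g : Module.End K (Path →₀ K)} (hf : Homogeneous k f)
    (hg : Homogeneous k g) : Homogeneous k (f + g) := by
  intro p q h
  by_cases h1 : f (Finsupp.single p 1) q = 0
  · refine hg p q fun h2 => h ?_
    rw [LinearMap.add_apply, Finsupp.add_apply, h1, h2, add_zero]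
  · exact hf p q h1

theorem Homogeneous.smul {k : ℤ} {f : Module.End K (Path →₀ K)} (hf : Homogeneous k f) (c : K) :
    Homogeneous k (c • f) := by
  intro p q h
  refine hf p q fun h2 => h ?_
  rw [LinearMap.smul_apply, Finsupp.smul_apply, h2, smul_zero]

theorem homogeneous_zero (k : ℤ) : Homogeneous k (0 : Module.End K (Path →₀ K)) :=
  fun _ _ h => absurd rfl h

theorem homogeneous_one : Homogeneous 0 (1 : Module.End K (Path →₀ K)) := by
  intro p q h
  rw [Module.End.one_apply, Finsupp.single_apply_ne_zero] at h
  rw [h.1]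
  simp

theorem homogeneous_rep_fgen (g : Gen (Fin 2) (Fin 4)) : Homogeneous g.deg (rep K (fgen K g)) := by
  intro p q h
  rw [rep_fgen_single] at h
  rcases g with v | e | e
  · rw [genPath] at h
    split_ifs at h
    · rw [Finsupp.single_apply_ne_zero] at h
      rw [h.1]
      simp [Gen.deg]
    · exact absurd rfl h
  · rw [genPath] at h
    split_ifs at h with hp
    · rw [Finsupp.single_apply_ne_zero] at h
      rw [h.1]
      simp [Gen.deg, final, next_bit, hp]
    · exact absurd rfl h
  · obtain ⟨v, _ | ⟨b, w⟩⟩ := p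
    · exact absurd rfl h
    · rw [genPath] at h
      split_ifs at h with hp
      · rw [Finsupp.single_apply_ne_zero] at h
        rw [h.1, hp.1, hp.2]
        simp [Gen.deg, final, next_bit]
      · exact absurd rfl h

/-- The operator vanishes on all long paths. -/
def EventuallyZero (f : Module.End K (Path →₀ K)) : Prop :=
  ∃ N : ℕ, ∀ p : Path, N ≤ p.2.length → f (Finsupp.single p 1) = 0

/-- The operator shortens paths by a bounded amount. -/
def Bounded (f : Module.End K (Path →₀ K)) : Prop :=
  ∃ D : ℕ, ∀ p q, f (Finsupp.single p 1) q ≠ 0 → p.2.length ≤ q.2.length + D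

theorem Homogeneous.bounded {k : ℤ} {f : Module.End K (Path →₀ K)} (hf : Homogeneous k f) :
    Bounded f :=
  ⟨k.natAbs, fun p q h => by have := (hf p q h).1; omega⟩

/-- Each generator changes lengths by at most one, and boundedness survives sums and products. It is
needed to make `kernel` closed under right multiplication. -/
theorem bounded_rep (x : FreeAlgebra K (Gen (Fin 2) (Fin 4))) : Bounded (rep K x) := by
  induction x using FreeAlgebra.induction with
  | grade0 c =>
    rw [AlgHom.commutes, Algebra.algebraMap_eq_smul_one]
    exact (homogeneous_one.smul c).bounded
  | grade1 g => exact (homogeneous_rep_fgen g).bounded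
  | mul x y hx hy =>
    obtain ⟨D, hD⟩ := hx
    obtain ⟨D', hD'⟩ := hy
    refine ⟨D + D', fun p q h => ?_⟩
    rw [map_mul] at h
    obtain ⟨r, h1, h2⟩ := exists_of_mul_ne_zero h
    have := hD r q h2
    have := hD' p r h1
    omega
  | add x y hx hy =>
    obtain ⟨D, hD⟩ := hx
    obtain ⟨D', hD'⟩ := hy
    refine ⟨max D D', fun p q h => ?_⟩
    rw [map_add, LinearMap.add_apply, Finsupp.add_apply] at h
    by_cases h1 : rep K x (Finsupp.single p 1) q = 0
    · rw [h1, zero_add] at h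
      have := hD' p q h
      omega
    · have := hD p q h1
      omega

theorem EventuallyZero.add {f g : Module.End K (Path →₀ K)} (hf : EventuallyZero f)
    (hg : EventuallyZero g) : EventuallyZero (f + g) := by
  obtain ⟨N, hN⟩ := hf
  obtain ⟨N', hN'⟩ := hg
  refine ⟨max N N', fun p hp => ?_⟩
  rw [LinearMap.add_apply, hN p (by omega), hN' p (by omega), add_zero]

theorem EventuallyZero.neg {f : Module.End K (Path →₀ K)} (hf : EventuallyZero f) :
    EventuallyZero (-f) := by
  obtain ⟨N, hN⟩ := hf
  exact ⟨N, fun p hp => by rw [LinearMap.neg_apply, hN p hp, neg_zero]⟩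

theorem EventuallyZero.mul_left {f : Module.End K (Path →₀ K)} (hf : EventuallyZero f)
    (g : Module.End K (Path →₀ K)) : EventuallyZero (g * f) := by
  obtain ⟨N, hN⟩ := hf
  exact ⟨N, fun p hp => by rw [Module.End.mul_apply, hN p hp, map_zero]⟩

/-- As g shortens paths by at most D, it maps paths of length at least N + D to combinations of
paths of length at least N, where f vanishes. -/
theorem EventuallyZero.mul_right {f g : Module.End K (Path →₀ K)} (hf : EventuallyZero f)
    (hg : Bounded g) : EventuallyZero (f * g) := by
  obtain ⟨N, hN⟩ := hf
  obtain ⟨D, hD⟩ := hg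
  refine ⟨N + D, fun p hp => ?_⟩
  rw [Module.End.mul_apply, apply_eq_sum]
  refine Finset.sum_eq_zero fun r hr => ?_
  dsimp only
  have := hD p r (Finsupp.mem_support_iff.1 hr)
  rw [hN r (by omega), smul_zero]

/-- The ideal of the elements of the free algebra which vanish on long paths. -/
def kernel (K : Type u) [Field K] : TwoSidedIdeal (FreeAlgebra K (Gen (Fin 2) (Fin 4))) :=
  TwoSidedIdeal.mk' {x | EventuallyZero (rep K x)}
    ⟨0, fun p _ => by rw [map_zero, LinearMap.zero_apply]⟩
    (fun {x y} hx hy => by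
      change EventuallyZero (rep K (x + y))
      rw [map_add]
      exact hx.add hy)
    (fun {x} hx => by
      change EventuallyZero (rep K (-x))
      rw [map_neg]
      exact hx.neg)
    (fun {x y} hy => by
      change EventuallyZero (rep K (x * y))
      rw [map_mul]
      exact hy.mul_left _)
    (fun {x y} hx => by
      change EventuallyZero (rep K (x * y))
      rw [map_mul]
      exact hx.mul_right (bounded_rep y))

theorem mem_kernel {x : FreeAlgebra K (Gen (Fin 2) (Fin 4))} :
    x ∈ kernel K ↔ EventuallyZero (rep K x) :=
  TwoSidedIdeal.mem_mk' _ _ _ _ _ _ _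

/-- The operator e e* projects onto the paths with first edge e, and a path of positive length has
exactly one first edge, determined by source and label. -/
theorem rep_edge_ghost (v : Fin 2) (p : Path) (hp : 1 ≤ p.2.length) :
    ∑ e ∈ Finset.univ.filter (fun e => exampleGraph.op.s e = v),
      rep K (fgen K (.edge e)) (rep K (fgen K (.ghost e)) (Finsupp.single p 1)) =
      genPath K (.vertex v) p := by
  obtain ⟨v', _ | ⟨b, w⟩⟩ := p
  · simp at hp
  · have h : ∀ e, rep K (fgen K (.edge e)) (rep K (fgen K (.ghost e))
        (Finsupp.single (v', b :: w) 1)) = if v' = exampleGraph.op.s e ∧ b = bit e then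
        Finsupp.single (v', b :: w) 1 else 0 := by
      intro e
      rw [rep_fgen_single, genPath]
      split_ifs with he
      · rw [rep_fgen_single, genPath, if_pos rfl, ← he.1, ← he.2]
      · rw [map_zero]
    simp only [h]
    rw [genPath]
    have hs : ∀ (v v' : Fin 2) (b : Bool), ∃ e, exampleGraph.op.s e = v' ∧ bit e = b ∧
      ∀ d, exampleGraph.op.s d = v' → bit d = b → d = e := by decide
    obtain ⟨e, rfl, rfl, hu⟩ := hs v v' b
    split_ifs with hv
    · subst hv
      rw [Finset.sum_eq_single e]
      · simp
      · intro d _ hd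
        rw [if_neg fun h => hd (hu d h.1.symm h.2.symm)]
      · simp
    · refine Finset.sum_eq_zero fun d hd => ?_
      rw [if_neg]
      rintro ⟨h, -⟩
      exact hv (h.trans (Finset.mem_filter.1 hd).2)

/-- The threshold 1 is forced by `sum_edge_ghost` alone; the other relations also hold on trivial
paths. -/
theorem sub_mem_kernel {x y : FreeAlgebra K (Gen (Fin 2) (Fin 4))}
    (h : LeavittRel K exampleGraph.op x y) : x - y ∈ kernel K := by
  rw [mem_kernel]
  refine ⟨1, fun p hp => ?_⟩
  rw [map_sub, LinearMap.sub_apply, sub_eq_zero]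
  cases h with
  | unit =>
    rw [map_one, Module.End.one_apply, map_sum, LinearMap.sum_apply]
    simp [rep_fgen_single, genPath]
  | vertex_mul v w =>
    rw [map_mul, Module.End.mul_apply, rep_fgen_single, genPath]
    split_ifs with h1 h2 h2
    · rw [rep_fgen_single, h2]
    · rw [rep_fgen_single, genPath, if_neg, map_zero, LinearMap.zero_apply]
      rintro h3
      exact h2 (h3.symm.trans h1)
    · rw [map_zero, rep_fgen_single, genPath, if_neg (h2 ▸ h1)]
    · rw [map_zero, map_zero, LinearMap.zero_apply]
  | source_edge e =>
    rw [map_mul, Module.End.mul_apply, rep_fgen_single, genPath]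
    split_ifs
    · rw [rep_fgen_single, genPath, if_pos rfl]
    · rw [map_zero]
  | edge_range e =>
    rw [map_mul, Module.End.mul_apply, rep_fgen_single, genPath]
    split_ifs with h
    · rw [rep_fgen_single]
    · rw [map_zero, rep_fgen_single, genPath, if_neg h]
  | range_ghost e =>
    rw [map_mul, Module.End.mul_apply, rep_fgen_single]
    obtain ⟨v, _ | ⟨b, w⟩⟩ := p
    · simp at hp
    · rw [genPath]
      split_ifs
      · rw [rep_fgen_single, genPath, if_pos rfl]
      · rw [map_zero]
  | ghost_source e =>
    rw [map_mul, Module.End.mul_apply, rep_fgen_single, genPath]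
    split_ifs with h
    · rw [rep_fgen_single]
    · rw [map_zero, rep_fgen_single]
      obtain ⟨v, _ | ⟨b, w⟩⟩ := p
      · simp at hp
      · rw [genPath, if_neg fun h' => h h'.1]
  | ghost_edge e d =>
    rw [map_mul, Module.End.mul_apply, rep_fgen_single, genPath]
    have hinj : ∀ e d, exampleGraph.op.s d = exampleGraph.op.s e → bit d = bit e → e = d := by
      decide
    split_ifs with h1 h2 h2
    · subst h2
      rw [rep_fgen_single, rep_fgen_single, genPath, genPath, if_pos ⟨rfl, rfl⟩, if_pos h1, ← h1]
    · rw [rep_fgen_single, genPath, if_neg fun h => h2 (hinj e d h.1 h.2), map_zero,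
        LinearMap.zero_apply]
    · rw [map_zero, rep_fgen_single, genPath, if_neg (h2 ▸ h1)]
    · rw [map_zero, map_zero, LinearMap.zero_apply]
  | sum_edge_ghost v _ =>
    rw [rep_fgen_single, ← rep_edge_ghost v p hp]
    simp

/-- The quotient of the free algebra by `kernel` satisfies the Leavitt relations, so it is a
quotient of L(Eᵒᵖ). Hence an element of L(Eᵒᵖ) determines its operator on long paths. -/
theorem eventuallyZero_of_mk_eq {x y : FreeAlgebra K (Gen (Fin 2) (Fin 4))}
    (h : Leavitt.mk K exampleGraph.op x = Leavitt.mk K exampleGraph.op y) :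
    EventuallyZero (rep K x - rep K y) := by
  let f := RingQuot.lift (r := LeavittRel K exampleGraph.op) ⟨(kernel K).ringCon.mk',
    fun {x y} h => (RingCon.eq _).2 (TwoSidedIdeal.rel_iff _ _ _ |>.2 (sub_mem_kernel h))⟩
  have hf : ∀ z, f (Leavitt.mk K exampleGraph.op z) = (kernel K).ringCon.mk' z := by
    intro z
    have : Leavitt.mk K exampleGraph.op z = RingQuot.mkRingHom (LeavittRel K exampleGraph.op) z :=
      DFunLike.congr_fun (RingQuot.mkAlgHom_coe K (LeavittRel K exampleGraph.op)) z
    rw [this]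
    exact RingQuot.lift_mkRingHom_apply _ _ z
  have h2 : (kernel K).ringCon x y := (RingCon.eq _).1 ((hf x).symm.trans
    ((congrArg f h).trans (hf y)))
  have h3 := mem_kernel.1 ((TwoSidedIdeal.rel_iff _ _ _).1 h2)
  rwa [map_sub] at h3

end PathTrace

/-! ### The twisted trace and its value at the identity -/

namespace PathTrace

open DirGraph

variable {K : Type u} [Field K]

/-- The trace of an operator on the span of the paths of length `n` which end at the vertex `0`. -/
noncomputable def levelTrace (f : Module.End K (Path →₀ K)) (n : ℤ) : K :=
  -- Fixing the end is essential: each vertex emits two edges, so counting all paths would give 2^n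
  -- for either vertex and not separate them.
  ∑ p ∈ paths n, if final p.1 p.2 = 0 then f (Finsupp.single p 1) p else 0

theorem levelTrace_add (f g : Module.End K (Path →₀ K)) :
    levelTrace (f + g) = levelTrace f + levelTrace g := by
  funext n
  simp only [levelTrace, Pi.add_apply, ← Finset.sum_add_distrib, LinearMap.add_apply,
    Finsupp.add_apply]
  exact Finset.sum_congr rfl fun p _ => by split_ifs <;> simp

/-- This is tr(fg) = tr(gf) for g going from level n to level n - k and f going back. Preservation
of ends lets the condition on the end pass from p to q wherever the matrix entry of g is nonzero. -/
theorem levelTrace_mul {k : ℤ} {f g : Module.End K (Path →₀ K)} (hf : Homogeneous k f)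
    (hg : Homogeneous (-k) g) (n : ℤ) : levelTrace (f * g) n = levelTrace (g * f) (n - k) := by
  have key : ∀ {k : ℤ} {f g : Module.End K (Path →₀ K)}, Homogeneous (-k) g → ∀ n p, p ∈ paths n →
      (f * g) (Finsupp.single p 1) p = ∑ q ∈ paths (n - k),
        g (Finsupp.single p 1) q * f (Finsupp.single q 1) p := by
    intro k f g hg n p hp
    rw [Module.End.mul_apply, apply_eq_sum, Finsupp.sum, Finsupp.finsetSum_apply]
    refine Finset.sum_subset (fun q hq => ?_) fun q _ hq => ?_
    · have := (hg p q (Finsupp.mem_support_iff.1 hq)).1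
      rw [mem_paths] at hp ⊢
      omega
    · rw [Finsupp.notMem_support_iff.1 hq, zero_smul]
      rfl
  have h1 : levelTrace (f * g) n = ∑ p ∈ paths n, ∑ q ∈ paths (n - k),
      if final p.1 p.2 = 0 then g (Finsupp.single p 1) q * f (Finsupp.single q 1) p else 0 := by
    refine Finset.sum_congr rfl fun p hp => ?_
    split_ifs
    · exact key hg n p hp
    · rw [Finset.sum_const_zero]
  have h2 : levelTrace (g * f) (n - k) = ∑ q ∈ paths (n - k), ∑ p ∈ paths n,
      if final q.1 q.2 = 0 then f (Finsupp.single q 1) p * g (Finsupp.single p 1) q else 0 := by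
    refine Finset.sum_congr rfl fun q hq => ?_
    split_ifs
    · have := key (k := -k) (f := g) (g := f) (by rwa [neg_neg]) (n - k) q hq
      rwa [sub_neg_eq_add, sub_add_cancel] at this
    · rw [Finset.sum_const_zero]
  rw [h1, h2, Finset.sum_comm]
  refine Finset.sum_congr rfl fun q _ => Finset.sum_congr rfl fun p _ => ?_
  by_cases hz : g (Finsupp.single p 1) q = 0
  · simp [hz]
  · rw [(hg p q hz).2, mul_comm]

theorem levelTrace_congr {f g : Module.End K (Path →₀ K)} (h : EventuallyZero (f - g)) :
    levelTrace f =ᶠ[Filter.atTop] levelTrace g := by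
  obtain ⟨N, hN⟩ := h
  filter_upwards [Filter.eventually_ge_atTop (N : ℤ)] with n hn
  refine Finset.sum_congr rfl fun p hp => ?_
  rw [mem_paths] at hp
  have := hN p (by omega)
  rw [LinearMap.sub_apply, sub_eq_zero] at this
  rw [this]

/-- Sequences up to eventual equality. -/
abbrev Values (K : Type u) : Type u := Filter.Germ (Filter.atTop : Filter ℤ) K

/-- The backward shift by `k` of sequences. -/
noncomputable def seqShift (k : ℤ) : Values K →+ Values K where
  toFun x := x.compTendsto (fun n : ℤ => n - k)
    (Filter.tendsto_atTop_add_const_right _ _ Filter.tendsto_id)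
  map_zero' := rfl
  map_add' x y := by
    induction x, y using Filter.Germ.inductionOn₂
    rfl

theorem seqShift_coe (k : ℤ) (f : ℤ → K) :
    seqShift k (f : Values K) = ((fun n => f (n - k) : ℤ → K) : Values K) := rfl

theorem seqShift_seqShift (k l : ℤ) (x : Values K) :
    seqShift k (seqShift l x) = seqShift (k + l) x := by
  induction x using Filter.Germ.inductionOn with
  | h f =>
    rw [seqShift_coe, seqShift_coe, seqShift_coe]
    exact congrArg _ (funext fun n => by rw [sub_sub])

/-- The twisted trace on the Leavitt path algebra. -/
noncomputable def trace : Leavitt K exampleGraph.op →+ Values K where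
  -- Different lifts of a to the free algebra have the same level traces for large n, so the germ at
  -- infinity does not depend on the chosen lift and is additive.
  toFun a := (levelTrace (rep K
    (Function.surjInv (Leavitt.mk_surjective K exampleGraph.op) a)) : Values K)
  map_zero' := by
    refine Filter.Germ.coe_eq.2 ((levelTrace_congr (g := 0) ?_).trans ?_)
    · have := eventuallyZero_of_mk_eq
        ((Function.surjInv_eq (Leavitt.mk_surjective K exampleGraph.op) 0).trans (map_zero _).symm)
      rwa [map_zero] at this
    · exact Filter.Eventually.of_forall fun n => Finset.sum_eq_zero fun p _ => by simp
  map_add' a b := by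
    refine Filter.Germ.coe_eq.2 ((levelTrace_congr ?_).trans (Filter.EventuallyEq.of_eq
      (levelTrace_add _ _)))
    rw [← map_add]
    refine eventuallyZero_of_mk_eq ?_
    have hs := Function.surjInv_eq (Leavitt.mk_surjective K exampleGraph.op)
    rw [map_add, hs, hs, hs]

theorem trace_mk (x : FreeAlgebra K (Gen (Fin 2) (Fin 4))) :
    trace (Leavitt.mk K exampleGraph.op x) = (levelTrace (rep K x) : Values K) :=
  Filter.Germ.coe_eq.2 (levelTrace_congr (eventuallyZero_of_mk_eq (Function.surjInv_eq _ _)))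

theorem exists_homogeneous {k : ℤ} {a : Leavitt K exampleGraph.op}
    (ha : a ∈ Leavitt.grading K exampleGraph.op k) :
    ∃ x, Leavitt.mk K exampleGraph.op x = a ∧ Homogeneous k (rep K x) := by
  refine Submodule.span_induction (p := fun a _ => ∃ x, Leavitt.mk K exampleGraph.op x = a ∧
    Homogeneous k (rep K x)) ?_ ?_ ?_ ?_ ha
  · rintro _ ⟨w, rfl, rfl⟩
    refine ⟨(w.map (fgen K)).prod, ?_, ?_⟩
    · rw [map_list_prod, List.map_map]
      rfl
    · clear ha
      induction w with
      | nil => simpa using homogeneous_one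
      | cons g w ih => simpa using (homogeneous_rep_fgen g).mul ih
  · exact ⟨0, map_zero _, by rw [map_zero]; exact homogeneous_zero k⟩
  · rintro _ _ _ _ ⟨x, rfl, hx⟩ ⟨y, rfl, hy⟩
    exact ⟨x + y, map_add _ _ _, by rw [map_add]; exact hx.add hy⟩
  · rintro c _ _ ⟨x, rfl, hx⟩
    exact ⟨c • x, map_smul _ _ _, by rw [map_smul]; exact hx.smul c⟩

/-- With homogeneous lifts of a and b, ab is traced on level n while ba is traced on level n - k;
this is the twist. -/
theorem trace_mul {k : ℤ} {a b : Leavitt K exampleGraph.op}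
    (ha : a ∈ Leavitt.grading K exampleGraph.op k)
    (hb : b ∈ Leavitt.grading K exampleGraph.op (-k)) :
    trace (a * b) = seqShift k (trace (b * a)) := by
  obtain ⟨x, rfl, hx⟩ := exists_homogeneous ha
  obtain ⟨y, rfl, hy⟩ := exists_homogeneous hb
  rw [← map_mul, ← map_mul, trace_mk, trace_mk, map_mul, map_mul, seqShift_coe]
  exact congrArg _ (funext fun n => levelTrace_mul hx hy n)

/-- The trace of the projection onto the paths starting at `v`. -/
noncomputable def vertexTrace (K : Type u) [Field K] (v : Fin 2) (n : ℤ) : K :=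
  levelTrace (rep K (fgen K (.vertex v))) n

/-- Write v = ∑ e e* and rotate: e e* on level n has the trace of e* e = r(e) on level n - 1.
Equivalently, paths are counted by their first edge. -/
theorem vertexTrace_of_pos (v : Fin 2) {n : ℤ} (hn : 1 ≤ n) :
    vertexTrace K v n = ∑ e ∈ Finset.univ.filter (fun e => exampleGraph.op.s e = v),
      vertexTrace K (exampleGraph.op.r e) (n - 1) := by
  have h : ∀ e, levelTrace (rep K (fgen K (.edge e)) * rep K (fgen K (.ghost e))) n =
      vertexTrace K (exampleGraph.op.r e) (n - 1) := by
    intro e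
    rw [levelTrace_mul (homogeneous_rep_fgen (.edge e)) (homogeneous_rep_fgen (.ghost e)),
      vertexTrace]
    refine Finset.sum_congr rfl fun p _ => ?_
    have : (rep K (fgen K (.ghost e)) * rep K (fgen K (.edge e))) (Finsupp.single p 1) =
        rep K (fgen K (.vertex (exampleGraph.op.r e))) (Finsupp.single p 1) := by
      rw [Module.End.mul_apply, rep_fgen_single, rep_fgen_single, genPath, genPath]
      split_ifs with hp
      · rw [rep_fgen_single, genPath, if_pos ⟨rfl, rfl⟩, ← hp]
      · rw [map_zero]
    rw [this]
  simp only [← h]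
  unfold vertexTrace levelTrace
  rw [Finset.sum_comm]
  refine Finset.sum_congr rfl fun p hp => ?_
  rw [mem_paths] at hp
  rw [rep_fgen_single, ← rep_edge_ghost v p (by omega), Finsupp.finsetSum_apply]
  split_ifs
  · rfl
  · rw [Finset.sum_const_zero]

theorem vertexTrace_zero_of_pos {n : ℤ} (hn : 1 ≤ n) :
    vertexTrace K 0 n = vertexTrace K 0 (n - 1) + vertexTrace K 1 (n - 1) := by
  rw [vertexTrace_of_pos 0 hn,
    show (Finset.univ.filter fun e => exampleGraph.op.s e = 0) = {0, 3} by decide,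
    Finset.sum_insert (by decide), Finset.sum_singleton]
  rfl

theorem vertexTrace_one_of_pos {n : ℤ} (hn : 1 ≤ n) :
    vertexTrace K 1 n = vertexTrace K 0 (n - 1) + vertexTrace K 0 (n - 1) := by
  rw [vertexTrace_of_pos 1 hn,
    show (Finset.univ.filter fun e => exampleGraph.op.s e = 1) = {1, 2} by decide,
    Finset.sum_insert (by decide), Finset.sum_singleton]
  rfl

/-- The row (1, -1) is a left eigenvector of the adjacency matrix of Eᵒᵖ with eigenvalue -1. On
level 0 only the trivial path at vertex 0 counts. -/
theorem vertexTrace_sub (n : ℕ) : vertexTrace K 0 n - vertexTrace K 1 n = (-1) ^ n := by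
  induction n with
  | zero =>
    have hp : paths ((0 : ℕ) : ℤ) = {(0, []), (1, [])} := by
      ext ⟨v, w⟩
      rw [mem_paths]
      fin_cases v <;> simp
    have h : ∀ v : Fin 2, vertexTrace K v ((0 : ℕ) : ℤ) = if v = 0 then 1 else 0 := by
      intro v
      rw [vertexTrace, levelTrace, hp, Finset.sum_insert (by simp), Finset.sum_singleton]
      fin_cases v <;> simp [rep_fgen_single, genPath, final]
    rw [h, h]
    simp
  | succ n ih =>
    have h1 : (1 : ℤ) ≤ ((n + 1 : ℕ) : ℤ) := by omega
    rw [vertexTrace_zero_of_pos h1, vertexTrace_one_of_pos h1,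
      show ((n + 1 : ℕ) : ℤ) - 1 = n by omega, pow_succ, ← ih]
    ring

theorem trace_one : trace (1 : Leavitt K exampleGraph.op) =
    ((vertexTrace K 0 + vertexTrace K 1 : ℤ → K) : Values K) := by
  rw [← Leavitt.sum_vertex, Fin.sum_univ_two, map_add, Leavitt.gen, Leavitt.gen, trace_mk, trace_mk]
  rfl

/-- The trace of the identity is not twice its backward shift. -/
theorem trace_one_ne : trace (1 : Leavitt K exampleGraph.op) ≠
    seqShift 1 (trace 1) + seqShift 1 (trace 1) := by
  rw [trace_one, seqShift_coe, ← Filter.Germ.coe_add]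
  intro h
  obtain ⟨n, hn, h1⟩ := ((Filter.Germ.coe_eq.1 h).and (Filter.eventually_ge_atTop 1)).exists
  obtain ⟨m, rfl⟩ := Int.eq_ofNat_of_zero_le (by omega : 0 ≤ n)
  simp only [Pi.add_apply] at hn
  -- The shifted trace of 1 is the trace of vertex 0 by the recursion, so the supposed equality
  -- reads t₀ + t₁ = t₀ + t₀ and forces t₀ = t₁.
  rw [← vertexTrace_zero_of_pos h1] at hn
  have hm := vertexTrace_sub (K := K) m
  rw [add_left_cancel hn, sub_self] at hm
  exact pow_ne_zero m (neg_ne_zero.2 one_ne_zero) hm.symm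

end PathTrace

/-! ### Homogeneous dual bases -/

section HomogeneousDualBasis

namespace DirectSum.IsInternal

variable {M N : Type*} [AddCommGroup M] [AddCommGroup N] {ℳ : ℤ → AddSubgroup M}

theorem exists_lift (h : DirectSum.IsInternal ℳ) (φ : ℤ → M →+ N) :
    ∃ f : M →+ N, ∀ k, ∀ m ∈ ℳ k, f m = φ k m := by
  let c := AddEquiv.ofBijective (DirectSum.coeAddMonoidHom ℳ) h
  refine ⟨(DirectSum.toAddMonoid fun k => (φ k).comp (ℳ k).subtype).comp c.symm.toAddMonoidHom,
    fun k m hm => ?_⟩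
  have : c.symm m = DirectSum.of (fun n => ℳ n) k ⟨m, hm⟩ := by
    rw [AddEquiv.symm_apply_eq]
    exact (DirectSum.coeAddMonoidHom_of ℳ k ⟨m, hm⟩).symm
  change DirectSum.toAddMonoid _ (c.symm m) = _
  rw [this, DirectSum.toAddMonoid_of]
  rfl

theorem addHom_ext (h : DirectSum.IsInternal ℳ) {f g : M →+ N}
    (hfg : ∀ k, ∀ m ∈ ℳ k, f m = g m) (m : M) : f m = g m := by
  obtain ⟨x, rfl⟩ := h.2 m
  induction x using DirectSum.induction_on with
  | zero => simp
  | of k m =>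
    rw [DirectSum.coeAddMonoidHom_of]
    exact hfg k m m.2
  | add x y hx hy => rw [map_add, map_add, map_add, hx, hy]

end DirectSum.IsInternal

variable {A σ : Type u} [Ring A] [SetLike σ A] {𝒜 : ℤ → σ}

namespace GrMod

/-- A dual basis of a graded module which consists of homogeneous elements and functionals. -/
structure IsDualBasis (M : GrMod 𝒜) {ι : Type} [Fintype ι] (p : ι → M.carrier) (d : ι → ℤ)
    (f : ι → M.carrier →ₗ[Aᵐᵒᵖ] A) : Prop where
  mem : ∀ i, p i ∈ M.comp (d i)
  map_mem : ∀ i k m, m ∈ M.comp k → f i m ∈ 𝒜 (k - d i)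
  sum : ∀ m, ∑ i, MulOpposite.op (f i m) • p i = m

theorem IsDualBasis.of_isoRel {M N : GrMod 𝒜} {ι : Type} [Fintype ι] {p : ι → M.carrier}
    {d : ι → ℤ} {f : ι → M.carrier →ₗ[Aᵐᵒᵖ] A} (h : M.IsDualBasis p d f)
    (e : M.carrier ≃ₗ[Aᵐᵒᵖ] N.carrier) (he : ∀ n m, m ∈ M.comp n ↔ e m ∈ N.comp n) :
    N.IsDualBasis (fun i => e (p i)) d (fun i => f i ∘ₗ e.symm.toLinearMap) where
  mem i := (he _ _).1 (h.mem i)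
  map_mem i k m hm := h.map_mem i k _ ((he _ _).2 (by rwa [LinearEquiv.coe_coe,
    LinearEquiv.apply_symm_apply]))
  sum m := by
    have := congrArg e (h.sum (e.symm m))
    rw [map_sum, LinearEquiv.apply_symm_apply] at this
    simpa using this

theorem IsDualBasis.shift {M : GrMod 𝒜} {ι : Type} [Fintype ι] {p : ι → M.carrier}
    {d : ι → ℤ} {f : ι → M.carrier →ₗ[Aᵐᵒᵖ] A} (h : M.IsDualBasis p d f) (α : ℤ) :
    (M.shift α).IsDualBasis p (fun i => d i - α) f where
  mem i := by
    change p i ∈ M.comp (d i - α + α)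
    rw [sub_add_cancel]
    exact h.mem i
  map_mem i k m hm := by
    have := h.map_mem i (k + α) m hm
    rwa [show k + α - d i = k - (d i - α) by ring] at this
  sum := h.sum

theorem IsDualBasis.prod {M N : GrMod 𝒜} {ι κ : Type} [Fintype ι] [Fintype κ]
    {p : ι → M.carrier} {d : ι → ℤ} {f : ι → M.carrier →ₗ[Aᵐᵒᵖ] A}
    {q : κ → N.carrier} {e : κ → ℤ} {g : κ → N.carrier →ₗ[Aᵐᵒᵖ] A}
    (h : M.IsDualBasis p d f) (h' : N.IsDualBasis q e g) :
    (M.prod N).IsDualBasis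
      (Sum.elim (fun i => (p i, (0 : N.carrier))) fun j => ((0 : M.carrier), q j)) (Sum.elim d e)
      (Sum.elim (fun i => f i ∘ₗ LinearMap.fst Aᵐᵒᵖ M.carrier N.carrier)
        fun j => g j ∘ₗ LinearMap.snd Aᵐᵒᵖ M.carrier N.carrier) where
  mem i := by
    rcases i with i | j
    · exact ⟨h.mem i, zero_mem _⟩
    · exact ⟨zero_mem _, h'.mem j⟩
  map_mem i k m hm := by
    rcases i with i | j
    · exact h.map_mem i k _ hm.1
    · exact h'.map_mem j k _ hm.2
  sum m := by
    rw [Fintype.sum_sum_type]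
    obtain ⟨m, n⟩ := m
    change ∑ i, MulOpposite.op (f i m) • (p i, (0 : N.carrier)) +
      ∑ j, MulOpposite.op (g j n) • ((0 : M.carrier), q j) = (m, n)
    refine Prod.ext ?_ ?_
    · rw [Prod.fst_add, Prod.fst_sum, Prod.fst_sum]
      simpa using h.sum m
    · rw [Prod.snd_add, Prod.snd_sum, Prod.snd_sum]
      simpa using h'.sum n

variable [AddSubgroupClass σ A] [GradedRing 𝒜]

theorem isDualBasis_regular (𝒜 : ℤ → σ) [GradedRing 𝒜] :
    (regular 𝒜).IsDualBasis (ι := Unit) (fun _ => (1 : A)) (fun _ => 0)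
      (fun _ => LinearMap.id) where
  mem _ := SetLike.one_mem_graded 𝒜
  map_mem _ k m hm := by
    rw [sub_zero]
    exact hm
  sum m := by
    rw [Fintype.sum_unique]
    exact _root_.one_mul (M := A) m

/-- An arbitrary dual basis is made homogeneous: each p_i is replaced by its finitely many
components π_d(p_i), each f_i by its parts of degree -d, and the dual-basis identity is read off in
each degree. -/
theorem FinProj.exists_isDualBasis {M : GrMod 𝒜} (hM : M.FinProj) :
    ∃ (ι : Type) (_ : Fintype ι) (p : ι → M.carrier) (d : ι → ℤ)
      (f : ι → M.carrier →ₗ[Aᵐᵒᵖ] A), M.IsDualBasis p d f := by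
  classical
  obtain ⟨_, _⟩ := hM
  obtain ⟨n, p, f, hpf⟩ := exists_dualBasis (A := A) (P := M.carrier)
  obtain ⟨π, mem, same, ne, sum⟩ := M.isInternal.exists_proj
  choose s hs0 hs using fun i => sum (p i)
  let D : Finset ℤ := Finset.univ.biUnion s
  have hsum : ∀ i, ∑ d ∈ D, π d (p i) = p i := by
    intro i
    conv_rhs => rw [← hs i]
    exact (Finset.sum_subset (Finset.subset_biUnion_of_mem s (Finset.mem_univ i))
      fun d _ hd => hs0 i d hd).symm
  have hproj : ∀ k l a, a ∈ 𝒜 l → GradedRing.proj 𝒜 k a = if k = l then a else 0 := by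
    intro k l a ha
    rw [GradedRing.proj_apply]
    split_ifs with h
    · rw [h, DirectSum.decompose_of_mem_same 𝒜 ha]
    · rw [DirectSum.decompose_of_mem_ne 𝒜 ha (Ne.symm h)]
  have hπ : ∀ i k a, π k (MulOpposite.op a • p i) =
      ∑ d ∈ D, MulOpposite.op (GradedRing.proj 𝒜 (k - d) a) • π d (p i) := by
    intro i k a
    induction a using DirectSum.Decomposition.inductionOn 𝒜 with
    | zero => simp
    | @homogeneous l a =>
      conv_lhs => rw [← hsum i]
      rw [Finset.smul_sum, map_sum]
      refine Finset.sum_congr rfl fun d _ => ?_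
      have hm := M.smul_mem (mem d (p i)) a.2
      rw [hproj _ _ _ a.2]
      split_ifs with h
      · exact same k _ (by rwa [show k = d + l by omega])
      · rw [ne k (d + l) (by omega) _ hm, MulOpposite.op_zero, zero_smul]
    | add a b ha hb =>
      simp only [MulOpposite.op_add, add_smul, map_add, ha, hb, Finset.sum_add_distrib]
  -- The part of f_i of degree -d sends m of degree k to the component of f_i(m) in degree k - d.
  -- Linearity over A is checked on homogeneous scalars and vectors.
  have hlift : ∀ (i : Fin n) (d : ℤ), ∃ h : M.carrier →ₗ[Aᵐᵒᵖ] A,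
      ∀ k, ∀ m ∈ M.comp k, h m = GradedRing.proj 𝒜 (k - d) (f i m) := by
    intro i d
    obtain ⟨h, hh⟩ := M.isInternal.exists_lift
      fun k => (GradedRing.proj 𝒜 (k - d)).comp (f i).toAddMonoidHom
    refine ⟨{ toFun := h, map_add' := map_add h, map_smul' := fun a m => ?_ }, hh⟩
    obtain ⟨a⟩ := a
    change h (MulOpposite.op a • m) = h m * a
    induction a using DirectSum.Decomposition.inductionOn 𝒜 with
    | zero => simp
    | @homogeneous l a =>
      refine M.isInternal.addHom_ext
        (f := h.comp (DistribSMul.toAddMonoidHom _ (MulOpposite.op (a : A))))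
        (g := (AddMonoidHom.mulRight (a : A)).comp h) (fun k m hm => ?_) m
      change h (MulOpposite.op (a : A) • m) = h m * a
      rw [hh k m hm, hh (k + l) _ (M.smul_mem hm a.2)]
      change GradedRing.proj 𝒜 (k + l - d) (f i (MulOpposite.op (a : A) • m)) =
        GradedRing.proj 𝒜 (k - d) (f i m) * a
      rw [map_smul, GradedRing.proj_apply, GradedRing.proj_apply,
        show k + l - d = (k - d) + l by ring]
      exact DirectSum.coe_decompose_mul_add_of_right_mem 𝒜 a.2
    | add a b ha hb => rw [MulOpposite.op_add, add_smul, map_add, ha, hb, mul_add]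
  choose h hh using hlift
  refine ⟨Fin n × D, inferInstance, fun z => π z.2 (p z.1), fun z => z.2, fun z => h z.1 z.2,
    ⟨fun z => mem _ _, fun z k m hm => ?_, fun m => ?_⟩⟩
  · rw [hh _ _ k m hm, GradedRing.proj_apply]
    exact SetLike.coe_mem _
  -- Packaging the expansion as an additive map reduces the identity to homogeneous m, where `hπ`
  -- applies.
  · let F : M.carrier →+ M.carrier := ∑ z : Fin n × D,
      ((LinearMap.toSpanSingleton Aᵐᵒᵖ M.carrier (π z.2 (p z.1))).toAddMonoidHom.comp
        MulOpposite.opAddEquiv.toAddMonoidHom).comp (h z.1 z.2).toAddMonoidHom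
    have hF : ∀ m, F m = ∑ z : Fin n × D, MulOpposite.op (h z.1 z.2 m) • π z.2 (p z.1) := by
      intro m
      rw [AddMonoidHom.finsetSum_apply]
      rfl
    rw [← hF]
    refine M.isInternal.addHom_ext (g := AddMonoidHom.id _) (fun k m hm => ?_) m
    rw [hF, AddMonoidHom.id_apply, Fintype.sum_prod_type]
    conv_rhs => rw [← same k m hm, ← hpf m, map_sum]
    refine Finset.sum_congr rfl fun i _ => ?_
    rw [hπ, ← Finset.sum_coe_sort D]
    exact Finset.sum_congr rfl fun d _ => by rw [hh i d k m hm]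

end GrMod

end HomogeneousDualBasis

/-! ### Graded Hattori–Stallings rank -/

namespace PathTrace

open DirGraph GrMod

variable {K : Type u} [Field K]

/-- The Hattori–Stallings rank computed in a homogeneous dual basis. -/
noncomputable def basisRank {M : GrMod (Leavitt.grading K exampleGraph.op)} {ι : Type} [Fintype ι]
    (p : ι → M.carrier) (d : ι → ℤ)
    (f : ι → M.carrier →ₗ[(Leavitt K exampleGraph.op)ᵐᵒᵖ] Leavitt K exampleGraph.op) : Values K :=
  ∑ i, seqShift (d i) (trace (f i (p i)))

variable {M N : GrMod (Leavitt.grading K exampleGraph.op)} {ι κ : Type} [Fintype ι] [Fintype κ]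

/-- Expand each basis in the other. The product f_i(q_j) g_j(p_i) has factors of degrees e_j - d_i
and d_i - e_j, so rotating it costs a shift by e_j - d_i, which turns the weight d_i into e_j. -/
theorem basisRank_eq {p : ι → M.carrier} {d : ι → ℤ}
    {f : ι → M.carrier →ₗ[(Leavitt K exampleGraph.op)ᵐᵒᵖ] Leavitt K exampleGraph.op}
    {q : κ → M.carrier} {e : κ → ℤ}
    {g : κ → M.carrier →ₗ[(Leavitt K exampleGraph.op)ᵐᵒᵖ] Leavitt K exampleGraph.op}
    (h : M.IsDualBasis p d f) (h' : M.IsDualBasis q e g) : basisRank p d f = basisRank q e g := by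
  have h1 : ∀ i, f i (p i) = ∑ j, f i (q j) * g j (p i) := by
    intro i
    conv_lhs => rw [← h'.sum (p i), map_sum]
    exact Finset.sum_congr rfl fun j _ => map_smul _ _ _
  have h2 : ∀ j, g j (q j) = ∑ i, g j (p i) * f i (q j) := by
    intro j
    conv_lhs => rw [← h.sum (q j), map_sum]
    exact Finset.sum_congr rfl fun i _ => map_smul _ _ _
  unfold basisRank
  simp only [h1, h2, map_sum]
  rw [Finset.sum_comm]
  refine Finset.sum_congr rfl fun j _ => Finset.sum_congr rfl fun i _ => ?_
  have hf := h.map_mem i (e j) _ (h'.mem j)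
  have hg := h'.map_mem j (d i) _ (h.mem i)
  rw [trace_mul hf (by rwa [neg_sub]), seqShift_seqShift, add_sub_cancel]

/-- The rank of a finitely generated projective graded module. -/
theorem exists_rank (hM : M.FinProj) : ∃ r : Values K, ∀ (ι : Type) (_ : Fintype ι)
    (p : ι → M.carrier) (d : ι → ℤ)
    (f : ι → M.carrier →ₗ[(Leavitt K exampleGraph.op)ᵐᵒᵖ] Leavitt K exampleGraph.op),
    M.IsDualBasis p d f → basisRank p d f = r := by
  obtain ⟨ι, _, p, d, f, h⟩ := hM.exists_isDualBasis
  exact ⟨basisRank p d f, fun κ _ q e g h' => basisRank_eq h' h⟩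

/-- The rank as a function on the classes of finitely generated projective graded modules. -/
noncomputable def rankFun (v : VGr (Leavitt.grading K exampleGraph.op)) : Values K :=
  Quotient.lift (fun M : {M : GrMod (Leavitt.grading K exampleGraph.op) // M.FinProj} =>
    (exists_rank M.2).choose) (by
    rintro M N ⟨e, he⟩
    obtain ⟨ι, _, p, d, f, h⟩ := M.2.exists_isDualBasis
    rw [← (exists_rank M.2).choose_spec ι _ p d f h,
      ← (exists_rank N.2).choose_spec ι _ _ _ _ (h.of_isoRel e he)]
    refine Finset.sum_congr rfl fun i _ => ?_
    rw [LinearMap.comp_apply, LinearEquiv.coe_coe, LinearEquiv.symm_apply_apply]) v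

theorem rankFun_mk (hM : M.FinProj) {p : ι → M.carrier} {d : ι → ℤ}
    {f : ι → M.carrier →ₗ[(Leavitt K exampleGraph.op)ᵐᵒᵖ] Leavitt K exampleGraph.op}
    (h : M.IsDualBasis p d f) : rankFun (VGr.mk M hM) = basisRank p d f :=
  ((exists_rank hM).choose_spec ι _ p d f h).symm

/-- The rank as a homomorphism. -/
noncomputable def rank : VGr (Leavitt.grading K exampleGraph.op) →+ Values K where
  toFun := rankFun
  map_zero' := by
    refine (rankFun_mk (ι := Empty) (p := Empty.elim) (d := Empty.elim) (f := Empty.elim)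
      FinProj.zero
      ⟨fun i => i.elim, fun i => i.elim,
        fun m => Subsingleton.elim (α := PUnit.{u + 1}) _ _⟩).trans ?_
    exact Finset.sum_empty
  map_add' := by
    rintro ⟨M, hM⟩ ⟨N, hN⟩
    obtain ⟨ι, _, p, d, f, h⟩ := hM.exists_isDualBasis
    obtain ⟨κ, _, q, e, g, h'⟩ := hN.exists_isDualBasis
    refine (rankFun_mk (hM.prod hN) (h.prod h')).trans ?_
    refine Eq.trans ?_ (congrArg₂ (· + ·) (rankFun_mk hM h) (rankFun_mk hN h')).symm
    exact Fintype.sum_sum_type _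

/-- The generator 1 of A(α) sits in degree -α. -/
theorem rank_shift_regular (α : ℤ) :
    rank (VGr.shift α (VGr.mk (GrMod.regular (Leavitt.grading K exampleGraph.op))
      (FinProj.regular _))) = seqShift (-α) (trace 1) := by
  have hd := (isDualBasis_regular (Leavitt.grading K exampleGraph.op)).shift α
  have h := rankFun_mk ((FinProj.regular (Leavitt.grading K exampleGraph.op)).shift α) hd
  refine Eq.trans (b := basisRank (M := (regular (Leavitt.grading K exampleGraph.op)).shift α)
    (ι := Unit) (fun _ => (1 : Leavitt K exampleGraph.op)) (fun _ => 0 - α)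
    (fun _ => LinearMap.id)) h ?_
  unfold basisRank
  refine (Fintype.sum_unique _).trans ?_
  rw [zero_sub]
  rfl

/-- The class of the algebra in the graded Grothendieck group is not twice its shift. -/
theorem unitClass_ne : (LaurentPolynomial.T (-1) : LaurentPolynomial ℤ) •
      K0Gr.unitClass (Leavitt.grading K exampleGraph.op) +
      (LaurentPolynomial.T (-1) : LaurentPolynomial ℤ) •
      K0Gr.unitClass (Leavitt.grading K exampleGraph.op) ≠
    K0Gr.unitClass (Leavitt.grading K exampleGraph.op) := by
  intro h
  -- The values form a group, so the rank extends to the group completion and can refute an identity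
  -- there, not only in the monoid.
  let R : K0Gr (Leavitt.grading K exampleGraph.op) →+ Values K :=
    Algebra.GrothendieckAddGroup.lift rank
  have hR : ∀ v, R (K0Gr.of _ v) = rank v := fun v => DFunLike.congr_fun
    (Algebra.GrothendieckAddGroup.lift.symm_apply_apply (rank (K := K))) v
  have h1 := congrArg R h
  have h0 := rank_shift_regular (K := K) 0
  rw [VGr.shift_zero] at h0
  rw [K0Gr.unitClass, K0Gr.T_smul_of, map_add, hR, hR, rank_shift_regular, h0] at h1
  refine trace_one_ne (K := K) ?_
  have h2 : ∀ x : Values K, seqShift (-0) x = x := by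
    intro x
    induction x using Filter.Germ.inductionOn with
    | h f =>
      rw [seqShift_coe]
      exact congrArg _ (funext fun n => by rw [neg_zero, sub_zero])
  rw [h2, neg_neg] at h1
  exact h1.symm

end PathTrace

/-! ### The relation 2x⁻¹[L(E)] = [L(E)] and the conclusions -/

section Example

open DirGraph

variable (K : Type u) [Field K]

/-- Homogeneous elements of `L(E)` which satisfy the relations of the Leavitt algebra of a graph
with one vertex and two loops. -/
theorem exampleGraph_exists_elements : ∃ x₁ x₂ y₁ y₂ : Leavitt K exampleGraph,
    x₁ ∈ Leavitt.grading K exampleGraph 1 ∧ x₂ ∈ Leavitt.grading K exampleGraph 1 ∧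
    y₁ ∈ Leavitt.grading K exampleGraph (-1) ∧ y₂ ∈ Leavitt.grading K exampleGraph (-1) ∧
    y₁ * x₁ = 1 ∧ y₂ * x₂ = 1 ∧ y₁ * x₂ = 0 ∧ y₂ * x₁ = 0 ∧ x₁ * y₁ + x₂ * y₂ = 1 := by
  have hx : ∀ i, Leavitt.gen K exampleGraph (.edge i) ∈ Leavitt.grading K exampleGraph 1 :=
    fun i => Leavitt.gen_mem K _ (.edge i)
  have hy : ∀ i, Leavitt.gen K exampleGraph (.ghost i) ∈ Leavitt.grading K exampleGraph (-1) :=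
    fun i => Leavitt.gen_mem K _ (.ghost i)
  have a0 := exampleGraph_sum_edge_ghost_zero K
  have a1 := exampleGraph_sum_edge_ghost_one K
  have a2 := exampleGraph_sum_vertex K
  -- Every vertex of E receives two edges, so the edges split into {0, 1} and {3, 2}, each with one
  -- edge into each vertex. Hence y x is the sum of the vertices within a class, and the cross terms
  -- of x y vanish.
  refine ⟨_, _, _, _, add_mem (hx 0) (hx 1), add_mem (hx 3) (hx 2), add_mem (hy 0) (hy 1),
    add_mem (hy 3) (hy 2), ?_, ?_, ?_, ?_, ?_⟩
  · simp [mul_add, add_mul, Leavitt.ghost_mul_edge, exampleGraph_r, a2]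
  · simp [mul_add, add_mul, Leavitt.ghost_mul_edge, exampleGraph_r, a2]
  · simp [mul_add, add_mul, Leavitt.ghost_mul_edge]
  · simp [mul_add, add_mul, Leavitt.ghost_mul_edge]
  · rw [← a2, ← a1, ← a0]
    simp [mul_add, add_mul, exampleGraph_edge_mul_ghost]
    abel

/-- The row (x₁, x₂) of degree 1 is invertible with inverse the column (y₁, y₂), so left
multiplication by it is an isomorphism A(-1) ⊕ A(-1) ≅ A. -/
theorem exampleGraph_shift_regular :
    VGr.shift (-1) (VGr.mk (GrMod.regular (Leavitt.grading K exampleGraph))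
        (GrMod.FinProj.regular _)) +
      VGr.shift (-1) (VGr.mk (GrMod.regular (Leavitt.grading K exampleGraph))
        (GrMod.FinProj.regular _)) =
      VGr.mk (GrMod.regular (Leavitt.grading K exampleGraph)) (GrMod.FinProj.regular _) := by
  obtain ⟨x₁, x₂, y₁, y₂, hx₁, hx₂, hy₁, hy₂, h11, h22, h12, h21, hs⟩ :=
    exampleGraph_exists_elements K
  let L := Leavitt K exampleGraph
  let e : (L × L) ≃ₗ[Lᵐᵒᵖ] L :=
    { toFun := fun z => x₁ * z.1 + x₂ * z.2
      invFun := fun a => (y₁ * a, y₂ * a)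
      map_add' := fun z w => by
        rw [Prod.fst_add, Prod.snd_add, mul_add, mul_add]
        abel
      map_smul' := fun a z => by
        change x₁ * (z.1 * a.unop) + x₂ * (z.2 * a.unop) = (x₁ * z.1 + x₂ * z.2) * a.unop
        rw [add_mul, mul_assoc, mul_assoc]
      left_inv := fun z => by
        simp only [mul_add, ← mul_assoc, h11, h12, h21, h22, one_mul, zero_mul, add_zero, zero_add]
      right_inv := fun a => by
        simp only [← mul_assoc, ← add_mul, hs, one_mul] }
  refine Quotient.sound (GrMod.isoRel_of_linearEquiv
    (M := ((GrMod.regular (Leavitt.grading K exampleGraph)).shift (-1)).prod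
      ((GrMod.regular (Leavitt.grading K exampleGraph)).shift (-1)))
    (N := GrMod.regular (Leavitt.grading K exampleGraph)) e ?_ ?_)
  · intro n z hz
    obtain ⟨(z₁ : L), (z₂ : L)⟩ := z
    obtain ⟨h1, h2⟩ := hz
    have h1' : x₁ * z₁ ∈ Leavitt.grading K exampleGraph (1 + (n + -1)) :=
      SetLike.mul_mem_graded hx₁ h1
    have h2' : x₂ * z₂ ∈ Leavitt.grading K exampleGraph (1 + (n + -1)) :=
      SetLike.mul_mem_graded hx₂ h2
    rw [show (1 : ℤ) + (n + -1) = n by ring] at h1' h2'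
    exact add_mem h1' h2'
  · intro n (a : L) ha
    have h1 : y₁ * a ∈ Leavitt.grading K exampleGraph (-1 + n) := SetLike.mul_mem_graded hy₁ ha
    have h2 : y₂ * a ∈ Leavitt.grading K exampleGraph (-1 + n) := SetLike.mul_mem_graded hy₂ ha
    rw [add_comm] at h1 h2
    exact ⟨h1, h2⟩

theorem exampleGraph_unitClass :
    (LaurentPolynomial.T (-1) : LaurentPolynomial ℤ) •
      K0Gr.unitClass (Leavitt.grading K exampleGraph) +
      (LaurentPolynomial.T (-1) : LaurentPolynomial ℤ) •
      K0Gr.unitClass (Leavitt.grading K exampleGraph) =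
    K0Gr.unitClass (Leavitt.grading K exampleGraph) := by
  rw [K0Gr.unitClass, K0Gr.T_smul_of, ← map_add, exampleGraph_shift_regular]

/-- The images of x₁, x₂, y₁, y₂ would give 1 as a sum of two products xy with yx = 1, so the trace
of 1 would be twice its shift. -/
theorem exampleGraph_not_gradedIsomorphic :
    ¬ GradedIsomorphic (Leavitt.grading K exampleGraph) (Leavitt.grading K exampleGraph.op) := by
  rintro ⟨φ, hφ⟩
  obtain ⟨x₁, x₂, y₁, y₂, hx₁, hx₂, hy₁, hy₂, h11, h22, -, -, hs⟩ :=
    exampleGraph_exists_elements K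
  refine PathTrace.trace_one_ne (K := K) ?_
  have h1 : φ x₁ * φ y₁ + φ x₂ * φ y₂ = 1 := by
    rw [← map_mul, ← map_mul, ← map_add, hs, map_one]
  conv_lhs => rw [← h1]
  rw [map_add, PathTrace.trace_mul ((hφ _ _).1 hx₁) ((hφ _ _).1 hy₁),
    PathTrace.trace_mul ((hφ _ _).1 hx₂) ((hφ _ _).1 hy₂), ← map_mul, ← map_mul, h11, h22, map_one]

theorem exampleGraph_strongShiftEquivalent :
    StrongShiftEquivalent exampleGraph.adjMatrix exampleGraph.op.adjMatrix := by
  -- Both factors are symmetric, so reversing their order transposes the product.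
  refine Relation.EqvGen.rel _ _ ⟨!![1, 1; 1, 0], !![1, 0; 0, 2], ?_, ?_⟩
  · change exampleGraph.adjMatrix = _
    decide
  · change exampleGraph.op.adjMatrix = _
    decide

end Example

theorem mainTheorem10 (K : Type u) [Field K] :
    -- the adjacency matrices of the graph and of its opposite
    exampleGraph.adjMatrix = !![1, 2; 1, 0] ∧
    exampleGraph.op.adjMatrix = !![1, 1; 2, 0] ∧
    -- they are strong shift equivalent
    StrongShiftEquivalent exampleGraph.adjMatrix exampleGraph.op.adjMatrix ∧
    -- the Leavitt path algebras are graded Morita equivalent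
    GradedMoritaEquivalent (DirGraph.Leavitt.grading K exampleGraph)
      (DirGraph.Leavitt.grading K exampleGraph.op) ∧
    -- the graded Grothendieck groups are isomorphic as preordered modules
    (∃ φ : K0Gr (DirGraph.Leavitt.grading K exampleGraph) ≃ₗ[LaurentPolynomial ℤ]
        K0Gr (DirGraph.Leavitt.grading K exampleGraph.op),
      K0Gr.OrderPreserving φ.toLinearMap ∧ K0Gr.OrderPreserving φ.symm.toLinearMap) ∧
    -- but there is no such isomorphism which preserves the class of the algebra
    (¬ ∃ φ : K0Gr (DirGraph.Leavitt.grading K exampleGraph) ≃ₗ[LaurentPolynomial ℤ]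
        K0Gr (DirGraph.Leavitt.grading K exampleGraph.op),
      K0Gr.OrderPreserving φ.toLinearMap ∧
        φ (K0Gr.unitClass (DirGraph.Leavitt.grading K exampleGraph)) =
          K0Gr.unitClass (DirGraph.Leavitt.grading K exampleGraph.op)) ∧
    -- and the Leavitt path algebras are not graded isomorphic
    ¬ GradedIsomorphic (DirGraph.Leavitt.grading K exampleGraph)
      (DirGraph.Leavitt.grading K exampleGraph.op) := by
  refine ⟨by decide, by decide, exampleGraph_strongShiftEquivalent,
    exampleGraph_gradedMoritaEquivalent K, exampleGraph_k0Gr K, ?_,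
    exampleGraph_not_gradedIsomorphic K⟩
  rintro ⟨φ, -, hφ⟩
  refine PathTrace.unitClass_ne (K := K) ?_
  -- A module isomorphism matching the unit classes would carry the relation 2x⁻¹[L(E)] = [L(E)]
  -- over to L(Eᵒᵖ).
  have h := congrArg φ (exampleGraph_unitClass K)
  rwa [map_add, map_smul, hφ] at h
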